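/- **Setting.** Let $V\in C^\infty(\mathbb R)$ with $\mathrm e^{-V}\in L^1(\mathbb R)$, and put $Z=\int_{\mathbb R}\mathrm e^{-V}$ and $\mu=Z^{-1}\mathrm e^{-V}\,\mathrm dx$. Let $J\ge 1$ and $\lambda_1,\dots,\lambda_J>0$. Let $f_1,\dots,f_J\in C^\infty(\mathbb R)\cap L^1(\mu)$, none of which is $\mu$-almost everywhere constant. For an observable $f$ write $I_f=\int f\,\mathrm d\mu$, and write $I_j=I_{f_j}$. For $U\colon\mathbb R\to\mathbb R$ let $Z[U]=\int_{\mathbb R}\mathrm e^{-V-U}$ and $\mu_U=Z[U]^{-1}\mathrm e^{-V-U}\,\mathrm dx$. **Admissible potentials.** Let $\mathfrak U_0$ be the set of $U\in C^\infty(\mathbb R)$ such that: 1. $\mathrm e^{-V-U}\in L^1(\mathbb R)$. 2. $\mu_U$ satisfies a Poincaré inequality: there is $R>0$ with $\|\varphi\|_{L^2(\mu_U)}^2\le R^{-1}\|\varphi'\|_{L^2(\mu_U)}^2$ for all $\varphi\in H^1(\mu_U)$ with $\int\varphi\,\mathrm d\mu_U=0$. 3. $(f_j-I_j)\,\mathrm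 e^U\in L^2(\mu_U)$ for $j=1,\dots,J$. 4. For every $x_0\in\mathbb R$, the equation $\mathrm dX_t=-(V+U)'(X_t)\,\mathrm dt+\sqrt2\,\mathrm dW_t$ with $X_0=x_0$ has a unique strong solution, global in time. **Asymptotic variance.** For an observable $f$ in the linear span of $f_1,\dots,f_J$ and $U\in\mathfrak U_0$, let $\phi_U\in H^1(\mu_U)$ be the unique distributional solution of $-\mathrm e^{V+U}(\mathrm e^{-V-U}\phi_U')'=(f-I_f)\,\mathrm e^U$ with $\int\phi_U\,\mathrm d\mu_U=0$. Define $$\sigma_f^2[U]=\frac{2Z[U]^2}{Z^2}\int_{\mathbb R}|\phi_U'|^2\,\mathrm d\mu_U .$$ Let $\sigma^2[U]=\mathbb E\bigl[\sigma^2_{f}[U]\bigr]$ for the random observable $f=\sum_{j=1}^J\sqrt{\lambda_j}\,u_jf_j$, where $u_1,\dots,u_J$ are independent standard Gaussian variables. Define also $$F_j(x)=\int_0^x(f_j-I_j)\,\mathrm e^{-V},\qquad A_{\mathbb R,j}=-\int_{-\infty}^0(f_j-I_j)\,\mathrm e^{-V}.$$ **Proposition.** Suppose that $0\in\mathfrak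 U_0$. Then: - $C_{\rm c}^\infty(\mathbb R)\subset\mathfrak U_0$. - For every $U\in\mathfrak U_0$, the solutions $\phi_U$ above exist and are unique up to null sets, the expectation defining $\sigma^2[U]$ is finite, and $\sigma^2[U]=\sum_{j=1}^J\lambda_j\,\sigma_{f_j}^2[U]$. - The function $\sqrt{\sum_{j}\lambda_j|F_j-A_{\mathbb R,j}|^2}$ is integrable over $\mathbb R$, and $$\inf_{U\in\mathfrak U_0}\sigma^2[U]=\inf_{U\in C_{\rm c}^\infty(\mathbb R)}\sigma^2[U]=\frac{2}{Z^2}\left(\int_{\mathbb R}\sqrt{\sum_{j=1}^J\lambda_j\,|F_j-A_{\mathbb R,j}|^2}\,\right)^2 .$$ -/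

import Mathlib

open MeasureTheory ProbabilityTheory
open scoped NNReal ContDiff

namespace BiasedLangevin

noncomputable section

/-- The space of smooth compactly supported functions on the real line. -/
def smoothCompact : Set (ℝ → ℝ) := {ψ | ContDiff ℝ ∞ ψ ∧ HasCompactSupport ψ}

/-- The normalization constant `∫ exp (-W)`. -/
def partition (W : ℝ → ℝ) : ℝ := ∫ x, Real.exp (-W x)

/-- The measure with Lebesgue density `exp (-W) / ∫ exp (-W)`. -/
def gibbs (W : ℝ → ℝ) : Measure ℝ := (volume : Measure ℝ).tilted (fun x => -W x)

/-- The mean of `f` with respect to the target measure. -/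
def mean (V f : ℝ → ℝ) : ℝ := ∫ x, f x ∂(gibbs V)

/-- `g` is the distributional derivative of `φ` on the real line. -/
structure HasWeakDeriv (φ g : ℝ → ℝ) : Prop where
  locallyIntegrable : LocallyIntegrable φ
  locallyIntegrable_deriv : LocallyIntegrable g
  integral_eq : ∀ ψ ∈ smoothCompact, ∫ x, φ x * deriv ψ x = - ∫ x, g x * ψ x

/-- `φ` is in `H¹(ν)`, with weak derivative `g`. -/
structure MemH1 (ν : Measure ℝ) (φ g : ℝ → ℝ) : Prop where
  hasWeakDeriv : HasWeakDeriv φ g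
  memLp : MemLp φ 2 ν
  memLp_deriv : MemLp g 2 ν

/-- The Poincaré inequality for `ν`, on the mean-zero functions of `H¹(ν)`. -/
def SatisfiesPoincare (ν : Measure ℝ) : Prop :=
  ∃ R : ℝ, 0 < R ∧ ∀ φ g : ℝ → ℝ, MemH1 ν φ g → ∫ x, φ x ∂ν = 0 →
    ∫ x, φ x ^ 2 ∂ν ≤ 1 / R * ∫ x, g x ^ 2 ∂ν

/-- The augmented natural filtration of a process `B` at time `t`: the sigma-algebra generated by
the values of `B` up to time `t` and by all null sets. -/
abbrev augmentedFiltration {Ω : Type} [MeasurableSpace Ω] (P : Measure Ω) (B : ℝ≥0 → Ω → ℝ)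
    (t : ℝ≥0) : MeasurableSpace Ω :=
  (⨆ s : Set.Iic t, MeasurableSpace.comap (B s) (borel ℝ)) ⊔
    MeasurableSpace.generateFrom {N : Set Ω | P N = 0}

/-- `X` is a strong solution, driven by the Brownian motion `B`, of
`dX_t = - W'(X_t) dt + √2 dB_t` with `X_0 = x₀`. As the noise is additive, the stochastic integral
of the constant `√2` is `√2 B_t`. -/
structure IsStrongSolution {Ω : Type} [MeasurableSpace Ω] (P : Measure Ω) (B : ℝ≥0 → Ω → ℝ)
    (W : ℝ → ℝ) (x₀ : ℝ) (X : ℝ≥0 → Ω → ℝ) : Prop where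
  adapted : ∀ t, Measurable[augmentedFiltration P B t] (X t)
  continuous : ∀ᵐ w ∂P, Continuous fun t => X t w
  equation : ∀ᵐ w ∂P, ∀ t : ℝ≥0,
    X t w = x₀ - (∫ s in (0 : ℝ)..t, deriv W (X s.toNNReal w)) + √2 * B t w

/-- Strong well-posedness of `dX_t = - W'(X_t) dt + √2 dB_t` with `X_0 = x₀`: for every Brownian
motion there is a strong solution, and any two of them are indistinguishable. -/
def HasUniqueStrongSolution (W : ℝ → ℝ) (x₀ : ℝ) : Prop :=
  ∀ (Ω : Type) (_ : MeasurableSpace Ω) (P : Measure Ω) (_ : IsProbabilityMeasure P)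
    (B : ℝ≥0 → Ω → ℝ), IsBrownianReal B P →
    (∃ X, IsStrongSolution P B W x₀ X) ∧
    ∀ X Y, IsStrongSolution P B W x₀ X → IsStrongSolution P B W x₀ Y →
      ∀ᵐ w ∂P, ∀ t, X t w = Y t w

/-- The set of admissible biasing potentials for the potential `V` and the observable `f`. -/
structure IsAdmissible (V f U : ℝ → ℝ) : Prop where
  smooth : ContDiff ℝ ∞ U
  integrable : Integrable fun x => Real.exp (-(V + U) x)
  poincare : SatisfiesPoincare (gibbs (V + U))
  memLp : MemLp (fun x => (f x - mean V f) * Real.exp (U x)) 2 (gibbs (V + U))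
  strongSolution : ∀ x₀ : ℝ, HasUniqueStrongSolution (V + U) x₀

/-- The biasing potentials that are admissible for every observable of a family. -/
def admissible {J : ℕ} (V : ℝ → ℝ) (f : Fin J → ℝ → ℝ) : Set (ℝ → ℝ) :=
  {U | ∀ j, IsAdmissible V (f j) U}

/-- `φ`, with weak derivative `g`, is a mean-zero distributional solution in `H¹(μ_U)` of the
Poisson equation `- exp (V + U) (exp (- V - U) φ')' = (f - μ(f)) exp U`. -/
structure IsPoissonSolution (V U f φ g : ℝ → ℝ) : Prop where
  memH1 : MemH1 (gibbs (V + U)) φ g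
  integral_eq_zero : ∫ x, φ x ∂(gibbs (V + U)) = 0
  weak : ∀ ψ ∈ smoothCompact, ∫ x, g x * deriv ψ x ∂(gibbs (V + U)) =
    ∫ x, (f x - mean V f) * Real.exp (U x) * ψ x ∂(gibbs (V + U))

/-- The Poisson equation has a solution, unique up to null sets. -/
def PoissonWellPosed (V U f : ℝ → ℝ) : Prop :=
  ∃ φ g : ℝ → ℝ, IsPoissonSolution V U f φ g ∧
    ∀ φ₁ g₁ : ℝ → ℝ, IsPoissonSolution V U f φ₁ g₁ →
      φ₁ =ᵐ[volume] φ ∧ g₁ =ᵐ[volume] g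

open Classical in
/-- The asymptotic variance `(2 Z[U]² / Z²) ∫ |φ_U'|² dμ_U`, where `φ_U` is the solution of the
Poisson equation. -/
def asymptoticVariance (V f U : ℝ → ℝ) : ℝ :=
  if h : ∃ p : (ℝ → ℝ) × (ℝ → ℝ), IsPoissonSolution V U f p.1 p.2 then
    2 * partition (V + U) ^ 2 / partition V ^ 2 *
      ∫ x, |(Classical.choose h).2 x| ^ 2 ∂(gibbs (V + U))
  else 0

/-- The observable `∑ √λ_j u_j f_j` with coefficients `u`. -/
def randomObservable {J : ℕ} (lam : Fin J → ℝ) (f : Fin J → ℝ → ℝ) (u : Fin J → ℝ) : ℝ → ℝ :=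
  fun x => ∑ j, √(lam j) * u j * f j x

/-- The law of `J` independent standard Gaussian variables. -/
def stdGaussianPi (J : ℕ) : Measure (Fin J → ℝ) := Measure.pi fun _ => gaussianReal 0 1

/-- The average of the asymptotic variance over the Gaussian random observable
`∑ √λ_j u_j f_j`. -/
def averagedVariance {J : ℕ} (V : ℝ → ℝ) (lam : Fin J → ℝ) (f : Fin J → ℝ → ℝ)
    (U : ℝ → ℝ) : ℝ :=
  ∫ u, asymptoticVariance V (randomObservable lam f u) U ∂(stdGaussianPi J)

/-- `F(x) = ∫_0^x (f - μ(f)) exp (-V)`. -/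
def primitiveF (V f : ℝ → ℝ) (x : ℝ) : ℝ :=
  ∫ ξ in (0 : ℝ)..x, (f ξ - mean V f) * Real.exp (-V ξ)

/-- `A_ℝ = - ∫_{-∞}^0 (f - μ(f)) exp (-V)`. -/
def constA (V f : ℝ → ℝ) : ℝ :=
  - ∫ ξ in Set.Iic (0 : ℝ), (f ξ - mean V f) * Real.exp (-V ξ)

/-- `√(∑ λ_j |F_j - A_{ℝ,j}|²)`. -/
def optimalDensity {J : ℕ} (V : ℝ → ℝ) (lam : Fin J → ℝ) (f : Fin J → ℝ → ℝ) (x : ℝ) : ℝ :=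
  √(∑ j, lam j * |primitiveF V (f j) x - constA V (f j)| ^ 2)

end

end BiasedLangevin

namespace BiasedLangevin

/-! Integrating the Poisson equation once gives `exp (-V-U) φ_U' = -H`, where `H = F - A_ℝ` is the
primitive of `(f - I_f) exp (-V)` vanishing at both ends of the line. The decisive point is that `H`
does not depend on `U`. Hence `σ_f²[U] = 2 Z[U] / Z² * ∫ H² exp (V+U)` (`asymptoticVariance_eq`).
This is quadratic in `f`, so averaging over independent standard Gaussians removes the cross terms
and leaves `2 / Z² * Z[U] * ∫ N exp (V+U)` with `N = ∑ λ_j H_j²` (`averagedVariance_eq_integral`).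

Cauchy-Schwarz bounds `Z[U] * ∫ N exp (V+U)` below by `(∫ √N)²` (`sq_integral_sqrt_le`). Equality
would require `exp (-V-U)` proportional to `√N`, a choice that need not be admissible and
degenerates where `N` vanishes. The value is approached instead by replacing `√N exp V` with a
positive smooth regularization and cutting off its logarithm (`le_sq_integral_sqrt`,
`le_of_forall_smoothCompact`).

Two analytic facts support this. First, the candidate solution lies in `H¹(μ_U)`: the Poincaré
inequality, applied to cut-off primitives, bounds their energy uniformly (`energy_cutoff_le`,
`integrable_sq_flux_and_primitive`). It is the only solution because `exp (V+U)` is not integrable.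
Second, compactly supported potentials are admissible. Bounded perturbations preserve the Poincaré
inequality. For the stochastic equation the noise is additive, so each path solves an ordinary
integral equation. An exploding path would have to leave the region where the drift was modified and
then overtake one of finitely many global solutions of the original equation
(`exists_upper_barrier`). Adaptedness holds because the solution is a limit of Picard iterates for
truncated drifts (`hasUniqueStrongSolution_of_deriv_eq`). -/

/-! ### Integral equations with additive noise: uniqueness and Picard iteration. -/

/-- Lipschitz continuity on bounded sets. -/
def LipschitzOnBounded (a : ℝ → ℝ) : Prop :=
  ∀ R : ℝ, ∃ L : ℝ, 0 ≤ L ∧ ∀ y ∈ Set.Icc (-R) R, ∀ z ∈ Set.Icc (-R) R, |a y - a z| ≤ L * |y - z|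

theorem lipschitzOnBounded_of_contDiff {a : ℝ → ℝ} (ha : ContDiff ℝ 1 a) :
    LipschitzOnBounded a := by
  intro R
  obtain ⟨C, hC⟩ := (isCompact_Icc (a := -R) (b := R)).exists_bound_of_continuousOn
    (ha.continuous_deriv le_rfl).continuousOn
  refine ⟨max C 0, le_max_right _ _, fun y hy z hz => ?_⟩
  have := (convex_Icc (-R) R).norm_image_sub_le_of_norm_deriv_le (f := a) (C := max C 0)
    (fun x _ => (ha.differentiable one_ne_zero).differentiableAt)
    (fun x hx => (hC x hx).trans (le_max_left _ _)) hz hy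
  simpa [Real.norm_eq_abs] using this

theorem intervalIntegral_comp_sub_comp {a X Y : ℝ → ℝ} (ha : Continuous a) (hX : Continuous X)
    (hY : Continuous Y) (r t : ℝ) :
    ∫ s in r..t, (a (X s) - a (Y s)) = (∫ s in r..t, a (X s)) - ∫ s in r..t, a (Y s) :=
  intervalIntegral.integral_sub ((ha.comp hX).intervalIntegrable _ _)
    ((ha.comp hY).intervalIntegrable _ _)

/-- Grönwall: on a compact interval both paths stay in a bounded set, where `a` is Lipschitz. Only
the difference enters, from an arbitrary initial time, so the same lemma serves for global
uniqueness and for uniqueness after two paths meet. -/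
theorem eq_of_sub_eq_integral {a : ℝ → ℝ} (ha : Continuous a) (hL : LipschitzOnBounded a)
    {X Y : ℝ → ℝ} (hX : Continuous X) (hY : Continuous Y) {r t : ℝ}
    (h : ∀ u ∈ Set.Icc r t, X u - Y u = ∫ s in r..u, (a (X s) - a (Y s))) :
    ∀ u ∈ Set.Icc r t, X u = Y u := by
  obtain ⟨C, hC⟩ := (isCompact_Icc (a := r) (b := t)).exists_bound_of_continuousOn
    (hX.continuousOn)
  obtain ⟨C', hC'⟩ := (isCompact_Icc (a := r) (b := t)).exists_bound_of_continuousOn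
    (hY.continuousOn)
  obtain ⟨L, hL0, hL⟩ := hL (max C C')
  set D : ℝ → ℝ := fun u => ∫ s in r..u, (a (X s) - a (Y s)) with hD
  have hcont : Continuous fun s => a (X s) - a (Y s) := by fun_prop
  have hderiv : ∀ u, HasDerivAt D (a (X u) - a (Y u)) u := fun u =>
    intervalIntegral.integral_hasDerivAt_right (hcont.intervalIntegrable _ _)
      (hcont.stronglyMeasurableAtFilter _ _) hcont.continuousAt
  have hzero : ∀ u ∈ Set.Icc r t, D u = 0 := by
    refine eq_zero_of_abs_deriv_le_mul_abs_self_of_eq_zero_right (K := L)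
      (f' := fun u => a (X u) - a (Y u))
      (fun u _ => (hderiv u).continuousAt.continuousWithinAt)
      (fun u _ => (hderiv u).hasDerivWithinAt) (by simp [hD]) (fun u hu => ?_)
    have hu' := Set.Ico_subset_Icc_self hu
    rw [show D u = X u - Y u from (h u hu').symm, Real.norm_eq_abs, Real.norm_eq_abs]
    refine hL _ (abs_le.1 ((hC u hu').trans (le_max_left _ _))) _
      (abs_le.1 ((hC' u hu').trans (le_max_right _ _)))
  intro u hu
  have := h u hu
  rw [show (∫ s in r..u, (a (X s) - a (Y s))) = 0 from hzero u hu] at this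
  linarith

theorem eq_of_integral_equation {a : ℝ → ℝ} (ha : Continuous a) (hL : LipschitzOnBounded a)
    {X Y γ : ℝ → ℝ} (hX : Continuous X) (hY : Continuous Y) {T : ℝ}
    (hXe : ∀ u ∈ Set.Icc 0 T, X u = γ u + ∫ s in (0 : ℝ)..u, a (X s))
    (hYe : ∀ u ∈ Set.Icc 0 T, Y u = γ u + ∫ s in (0 : ℝ)..u, a (Y s)) :
    ∀ u ∈ Set.Icc 0 T, X u = Y u := by
  refine eq_of_sub_eq_integral ha hL hX hY fun u hu => ?_
  rw [intervalIntegral_comp_sub_comp ha hX hY, hXe u hu, hYe u hu]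
  ring

/-- The Picard iterates of the equation `X t = γ t + ∫_0^t b (X s) ds`. -/
noncomputable def picardIterate (b γ : ℝ → ℝ) : ℕ → ℝ → ℝ
  | 0 => γ
  | k + 1 => fun t => γ t + ∫ s in (0 : ℝ)..t, b (picardIterate b γ k s)

theorem continuous_picardIterate {b γ : ℝ → ℝ} (hb : Continuous b) (hγ : Continuous γ) (k : ℕ) :
    Continuous (picardIterate b γ k) := by
  induction k with
  | zero => exact hγ
  | succ k ih =>
    exact hγ.add (intervalIntegral.continuous_primitive
      (fun _ _ => (hb.comp ih).intervalIntegrable _ _) 0)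

/-- The first increment is at most `C * t` because `b` is bounded; each later one is at most `L`
times the integral of its predecessor. -/
theorem abs_picardIterate_succ_sub_le {b γ : ℝ → ℝ} (hb : Continuous b) (hγ : Continuous γ)
    {C L : ℝ} (hC : ∀ y, |b y| ≤ C) (hL0 : 0 ≤ L) (hL : ∀ y z, |b y - b z| ≤ L * |y - z|) (k : ℕ) :
    ∀ t, 0 ≤ t → |picardIterate b γ (k + 1) t - picardIterate b γ k t| ≤
      C * t * ((L * t) ^ k / k.factorial) := by
  have hC0 : 0 ≤ C := (abs_nonneg _).trans (hC 0)
  have hcont := continuous_picardIterate hb hγ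
  induction k with
  | zero =>
    intro t ht
    have := intervalIntegral.norm_integral_le_of_norm_le_const (a := 0) (b := t) (C := C)
      (f := fun s => b (γ s)) (fun s _ => hC _)
    simpa [picardIterate, abs_of_nonneg ht] using this
  | succ k ih =>
    intro t ht
    have h1 : picardIterate b γ (k + 1 + 1) t - picardIterate b γ (k + 1) t =
        ∫ s in (0 : ℝ)..t, (b (picardIterate b γ (k + 1) s) - b (picardIterate b γ k s)) := by
      rw [intervalIntegral_comp_sub_comp hb (hcont _) (hcont _)]
      simp only [picardIterate]
      ring
    have hpow : Continuous fun s : ℝ => C * L ^ (k + 1) / k.factorial * s ^ (k + 1) := by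
      fun_prop
    have h2 : |∫ s in (0 : ℝ)..t, (b (picardIterate b γ (k + 1) s) - b (picardIterate b γ k s))| ≤
        ∫ s in (0 : ℝ)..t, C * L ^ (k + 1) / k.factorial * s ^ (k + 1) := by
      rw [← Real.norm_eq_abs]
      refine intervalIntegral.norm_integral_le_of_norm_le ht (Filter.Eventually.of_forall
        fun s hs => ?_) (hpow.intervalIntegrable (μ := volume) _ _)
      refine (hL _ _).trans ((mul_le_mul_of_nonneg_left (ih s hs.1.le) hL0).trans (le_of_eq ?_))
      rw [mul_pow]
      ring
    rw [h1]
    refine h2.trans ?_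
    rw [intervalIntegral.integral_const_mul, integral_pow, Nat.factorial_succ]
    have hk : (0 : ℝ) < k.factorial := by positivity
    have e1 : C * L ^ (k + 1) / k.factorial * ((t ^ (k + 1 + 1) - 0 ^ (k + 1 + 1)) / ((k + 1 : ℕ) + 1))
        = C * t * (L * t) ^ (k + 1) / (k.factorial * ((k : ℝ) + 2)) := by
      rw [mul_pow]; push_cast; field_simp; ring
    rw [e1, mul_div_assoc]
    push_cast
    -- Integration yields the denominator `k! * (k + 2)`, which exceeds the `k! * (k + 1)` required.
    gcongr C * t * ((L * t) ^ (k + 1) / ?_)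
    nlinarith

/-- Convergence of the iterates is kept in the conclusion, since measurability in the noise passes
through this limit. -/
theorem exists_tendsto_picardIterate {b γ : ℝ → ℝ} (hb : Continuous b) (hγ : Continuous γ)
    {C L : ℝ} (hC : ∀ y, |b y| ≤ C) (hL0 : 0 ≤ L) (hL : ∀ y z, |b y - b z| ≤ L * |y - z|) :
    ∃ X : ℝ → ℝ, Continuous X ∧
      (∀ t, 0 ≤ t → Filter.Tendsto (fun k => picardIterate b γ k t) Filter.atTop (nhds (X t))) ∧
      ∀ t, 0 ≤ t → X t = γ t + ∫ s in (0 : ℝ)..t, b (X s) := by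
  have hcont := continuous_picardIterate hb hγ
  have hC0 : 0 ≤ C := (abs_nonneg _).trans (hC 0)
  have hcauchy : ∀ t, 0 ≤ t → ∃ x, Filter.Tendsto (fun k => picardIterate b γ k t)
      Filter.atTop (nhds x) := by
    intro t ht
    refine cauchySeq_tendsto_of_complete (cauchySeq_of_dist_le_of_summable _ (fun k => ?_)
      ((Real.summable_pow_div_factorial (L * t)).mul_left (C * t)))
    rw [dist_comm, Real.dist_eq]
    exact abs_picardIterate_succ_sub_le hb hγ hC hL0 hL k t ht
  -- Clamping at time zero makes `Y` a pointwise limit on the whole line, hence measurable.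
  choose Y hY using fun t : ℝ => hcauchy (max t 0) (le_max_right _ _)
  have hY' : ∀ t, 0 ≤ t → Filter.Tendsto (fun k => picardIterate b γ k t)
      Filter.atTop (nhds (Y t)) := fun t ht => by
    have := hY t
    rwa [max_eq_left ht] at this
  have hYm : Measurable Y := measurable_of_tendsto_metrizable
    (fun k => ((hcont k).comp (continuous_id.max continuous_const)).measurable)
    (tendsto_pi_nhds.2 hY)
  have hint : ∀ t, IntervalIntegrable (fun s => b (Y s)) volume 0 t := fun t =>
    (intervalIntegrable_const (c := C)).mono_fun (hb.measurable.comp hYm).aestronglyMeasurable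
      (Filter.Eventually.of_forall fun s => by
        simpa [abs_of_nonneg hC0] using hC (Y s))
  have heq : ∀ t, 0 ≤ t → Y t = γ t + ∫ s in (0 : ℝ)..t, b (Y s) := by
    intro t ht
    refine tendsto_nhds_unique ((hY' t ht).comp (Filter.tendsto_add_atTop_nat 1)) ?_
    refine tendsto_const_nhds.add
      (intervalIntegral.tendsto_integral_filter_of_dominated_convergence (fun _ => C)
        (Filter.Eventually.of_forall fun k => (hb.comp (hcont k)).aestronglyMeasurable)
        (Filter.Eventually.of_forall fun k => Filter.Eventually.of_forall fun s _ => hC _)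
        intervalIntegrable_const (Filter.Eventually.of_forall fun s hs => ?_))
    rw [Set.uIoc_of_le ht] at hs
    exact (hb.tendsto _).comp (hY' s hs.1.le)
  -- The limit `Y` is known only to be measurable; the right-hand side of its equation agrees with
  -- it for nonnegative times and is continuous.
  refine ⟨fun t => γ t + ∫ s in (0 : ℝ)..t, b (Y s), hγ.add
    (intervalIntegral.continuous_primitive (fun u v => (hint u).symm.trans (hint v)) 0),
    fun t ht => ?_, fun t ht => ?_⟩
  · simpa only [← heq t ht] using hY' t ht
  · refine congrArg (γ t + ·) (intervalIntegral.integral_congr fun s hs => ?_)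
    rw [Set.uIcc_of_le ht] at hs
    simp only [← heq s hs.1]

/-! ### Barriers against explosion. -/

/-- The equation with drift `a` and additive noise `γ` has a global solution started at every
rational time from every integer. -/
def SolvableFromRational (a γ : ℝ → ℝ) : Prop :=
  ∀ (q : ℚ) (n : ℤ), 0 ≤ q → ∃ Z : ℝ → ℝ, Continuous Z ∧
    ∀ u, (q : ℝ) ≤ u → Z u = n + (∫ s in (q : ℝ)..u, a (Z s)) + γ u - γ q

theorem SolvableFromRational.reflect {a γ : ℝ → ℝ} (h : SolvableFromRational a γ) :
    SolvableFromRational (fun y => -a (-y)) (fun t => -γ t) := by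
  intro q n hq
  obtain ⟨Z, hZ, hZe⟩ := h q (-n) hq
  refine ⟨fun t => -Z t, hZ.neg, fun u hu => ?_⟩
  simp only [neg_neg, intervalIntegral.integral_neg, hZe u hu]
  push_cast
  ring

theorem integral_equation_sub {b X γ : ℝ → ℝ} (hb : Continuous b) (hX : Continuous X) {T : ℝ}
    (hXe : ∀ t ∈ Set.Icc 0 T, X t = γ t + ∫ s in (0 : ℝ)..t, b (X s)) {u v : ℝ}
    (hu : u ∈ Set.Icc 0 T) (hv : v ∈ Set.Icc 0 T) :
    X v - X u = (∫ s in u..v, b (X s)) + (γ v - γ u) := by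
  have hc : ∀ u v, IntervalIntegrable (fun s => b (X s)) volume u v :=
    (hb.comp hX).intervalIntegrable
  rw [hXe u hu, hXe v hv, ← intervalIntegral.integral_add_adjacent_intervals (hc 0 u) (hc u v)]
  ring

/-- A solution cannot cross a large gap quickly. -/
theorem lt_add_two_of_small_time {b X γ : ℝ → ℝ} (hX : Continuous X)
    {s t m c : ℝ} (hs : X s ≤ m) (hm : ∀ u ∈ Set.Ioc s t, m < X u)
    (hXe : ∀ u ∈ Set.Icc s t, X u - X s = (∫ r in s..u, b (X r)) + (γ u - γ s))
    (hc : ∀ y ∈ Set.Icc m (m + 2), |b y| ≤ c)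
    (hsmall : ∀ u ∈ Set.Icc s t, c * (u - s) + (γ u - γ s) < 2) :
    ∀ u ∈ Set.Icc s t, X u < m + 2 := by
  by_contra! hcon
  obtain ⟨v, hv, hXv⟩ := hcon
  have hK : IsCompact {r ∈ Set.Icc s t | m + 2 ≤ X r} :=
    isCompact_Icc.inter_right (isClosed_le continuous_const hX)
  -- Up to the first time `w` at level `m + 2` the path lies in the strip where the drift is at most
  -- `c`.
  obtain ⟨w, ⟨hw, hXw⟩, hwmin⟩ := hK.exists_isLeast ⟨v, hv, hXv⟩
  have hlt : ∀ r ∈ Set.Ioc s w, r < w → X r < m + 2 := fun r hr hrw => by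
    by_contra! h
    exact absurd (hwmin ⟨⟨hr.1.le, hrw.le.trans hw.2⟩, h⟩) (not_le.2 hrw)
  have hint : |∫ r in s..w, b (X r)| ≤ c * (w - s) := by
    rw [← abs_of_nonneg (sub_nonneg.2 hw.1), ← Real.norm_eq_abs]
    have hle : X w ≤ m + 2 := by
      by_contra! h
      obtain ⟨r, hr, hXr⟩ := intermediate_value_Ioo hw.1 hX.continuousOn
        (show m + 2 ∈ Set.Ioo (X s) (X w) from ⟨by linarith, h⟩)
      exact (hlt r ⟨hr.1, hr.2.le⟩ hr.2).ne hXr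
    refine intervalIntegral.norm_integral_le_of_norm_le_const fun r hr => ?_
    rw [Set.uIoc_of_le hw.1] at hr
    refine hc _ ⟨(hm r ⟨hr.1, hr.2.trans hw.2⟩).le, ?_⟩
    rcases hr.2.lt_or_eq with h | h
    · exact (hlt r hr h).le
    · exact h ▸ hle
  have := hXe w hw
  have := hsmall w hw
  have := (abs_le.1 hint).2
  linarith

/-- Comparison: while the drifts agree, a solution stays below one that starts above it. -/
theorem le_of_le_initial {a b X Z γ : ℝ → ℝ} (ha : Continuous a) (hL : LipschitzOnBounded a)
    (hX : Continuous X) (hZ : Continuous Z) {q t : ℝ}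
    (hq : X q ≤ Z q)
    (hXe : ∀ u ∈ Set.Icc q t, ∀ v ∈ Set.Icc q t,
      X v - X u = (∫ r in u..v, b (X r)) + (γ v - γ u))
    (hZe : ∀ u ∈ Set.Icc q t, ∀ v ∈ Set.Icc q t,
      Z v - Z u = (∫ r in u..v, a (Z r)) + (γ v - γ u))
    (hab : ∀ u ∈ Set.Icc q t, b (X u) = a (X u)) (hqt : q ≤ t) : X t ≤ Z t := by
  by_contra! hcon
  -- To end above `Z`, the path must meet `Z` at some time `r`; uniqueness from `r` on then forces
  -- equality at `t`.
  obtain ⟨r, hr, hr0⟩ := intermediate_value_Icc hqt (hX.sub hZ).continuousOn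
    (show (0 : ℝ) ∈ Set.Icc ((X - Z) q) ((X - Z) t) from
      ⟨by simpa using hq, by simpa using hcon.le⟩)
  have hr0 : X r = Z r := by simpa [sub_eq_zero] using hr0
  have := eq_of_sub_eq_integral ha hL hX hZ (r := r) (t := t) (fun u hu => ?_) t ⟨hr.2, le_rfl⟩
  · exact hcon.ne this.symm
  · have hu' : u ∈ Set.Icc q t := ⟨hr.1.trans hu.1, hu.2⟩
    have e1 := hXe r hr u hu'
    have e2 := hZe r hr u hu'
    rw [intervalIntegral_comp_sub_comp ha hX hZ]
    have : ∫ s in r..u, b (X s) = ∫ s in r..u, a (X s) :=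
      intervalIntegral.integral_congr fun s hs => by
        rw [Set.uIcc_of_le hu.1] at hs
        exact hab s ⟨hr.1.trans hs.1, hs.2.trans hu.2⟩
    linarith

/-- If the equation with drift `a` does not explode, then drifts that agree with `a` near `+∞`
have solutions that are bounded above, uniformly in the drift. -/
theorem exists_upper_barrier {a₁ a γ : ℝ → ℝ} (ha : Continuous a)
    (hL : LipschitzOnBounded a)
    (hγ : Continuous γ) (h : SolvableFromRational a γ) (K T : ℝ) (hK : ∀ y, K ≤ y → a₁ y = a y) :
    ∃ M : ℝ, ∀ b : ℝ → ℝ, Continuous b → (∀ y ∈ Set.Icc K M, b y = a₁ y) →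
      ∀ X : ℝ → ℝ, Continuous X →
        (∀ t ∈ Set.Icc 0 T, X t = γ t + ∫ s in (0 : ℝ)..t, b (X s)) →
        ∀ t ∈ Set.Icc 0 T, X t < M := by
  set m := max K (γ 0) with hm
  obtain ⟨c₀, hc₀⟩ := (isCompact_Icc (a := m) (b := m + 2)).exists_bound_of_continuousOn
    ha.continuousOn
  set c := max c₀ 1 with hcdef
  have hc : ∀ y ∈ Set.Icc m (m + 2), |a y| ≤ c := fun y hy => (hc₀ y hy).trans (le_max_left _ _)
  have hc1 : 1 ≤ c := le_max_right _ _
  obtain ⟨d, hd0, hd⟩ := Metric.uniformContinuousOn_iff.1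
    ((isCompact_Icc (a := 0) (b := T)).uniformContinuousOn_of_continuous hγ.continuousOn) 1 one_pos
  -- Within one mesh `1 / p` the drift contributes less than `1` and the noise less than `1`, so a
  -- path starting at `m` stays below `m + 2`.
  obtain ⟨p, hp⟩ := exists_nat_gt (max (1 / d) c)
  have hp1 : 1 / d < p := (le_max_left _ _).trans_lt hp
  have hpc : c < p := (le_max_right _ _).trans_lt hp
  have hp0 : (0 : ℝ) < p := by linarith
  obtain ⟨N, hN⟩ := exists_int_gt (m + 2)
  -- Finitely many reference solutions matter: one per grid time up to `T`, each started at the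
  -- integer `N` above `m + 2`. The barrier `M` exceeds all of them on `[0, T]` and is fixed before
  -- the drift `b` is given.
  choose Z hZ hZe using fun k : ℕ => h ((k : ℚ) / p) N (by positivity)
  choose C hC using fun k : ℕ => (isCompact_Icc (a := 0) (b := T)).exists_bound_of_continuousOn
    (hZ k).continuousOn
  obtain ⟨M₀, hM₀⟩ := ((Finset.range (⌈T * p⌉₊ + 1)).image C).exists_le
  set M := max M₀ (m + 2) + 1 with hM
  have hMm : m + 3 ≤ M := by have := le_max_right M₀ (m + 2); linarith
  have hMC : ∀ k ≤ ⌈T * p⌉₊, C k < M := fun k hk => by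
    have := hM₀ (C k) (Finset.mem_image_of_mem _ (Finset.mem_range.2 (by omega)))
    have := le_max_left M₀ (m + 2)
    linarith
  have hKm : K ≤ m := le_max_left _ _
  refine ⟨M, fun b hb hbM X hX hXe => ?_⟩
  by_contra! hcon
  obtain ⟨v, hv, hXv⟩ := hcon
  have hX0 : X 0 ≤ m := by
    rw [hXe 0 ⟨le_rfl, hv.1.trans hv.2⟩]
    simp [hm]
  -- Here `t` is the first time at level `M`, and below `s` is the last time before `t` at level
  -- `m`. Between them the path stays in `[m, M]`, where `b` agrees with `a`.
  obtain ⟨t, ⟨ht, hXt⟩, htmin⟩ := (isCompact_Icc.inter_right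
    (isClosed_le continuous_const hX) : IsCompact {r ∈ Set.Icc 0 v | M ≤ X r}).exists_isLeast
    ⟨v, ⟨hv.1, le_rfl⟩, hXv⟩
  have htT : t ≤ T := ht.2.trans hv.2
  have hlt : ∀ r ∈ Set.Icc 0 t, r ≠ t → X r < M := fun r hr hrt => by
    by_contra! hh
    exact hrt (le_antisymm hr.2 (htmin ⟨⟨hr.1, hr.2.trans ht.2⟩, hh⟩))
  have hXtM : X t = M := by
    refine le_antisymm ?_ hXt
    by_contra! hh
    obtain ⟨r, hr, hXr⟩ := intermediate_value_Ioo ht.1 hX.continuousOn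
      (show M ∈ Set.Ioo (X 0) (X t) from ⟨by linarith, hh⟩)
    exact (hlt r ⟨hr.1.le, hr.2.le⟩ hr.2.ne).ne hXr
  obtain ⟨s, ⟨hs, hXs⟩, hsmax⟩ := (isCompact_Icc.inter_right
    (isClosed_le hX continuous_const) : IsCompact {r ∈ Set.Icc 0 t | X r ≤ m}).exists_isGreatest
    ⟨0, ⟨le_rfl, ht.1⟩, hX0⟩
  have hgt : ∀ r ∈ Set.Ioc s t, m < X r := fun r hr => by
    by_contra! hh
    exact absurd (hsmax ⟨⟨hs.1.trans hr.1.le, hr.2⟩, hh⟩) (not_le.2 hr.1)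
  have hXsm : X s = m := by
    refine le_antisymm hXs ?_
    by_contra! hh
    obtain ⟨r, hr, hXr⟩ := intermediate_value_Ioo hs.2 hX.continuousOn
      (show m ∈ Set.Ioo (X s) (X t) from ⟨hh, by linarith⟩)
    exact (hgt r ⟨hr.1, hr.2.le⟩).ne' hXr
  have hinc : ∀ u ∈ Set.Icc s t, ∀ v ∈ Set.Icc s t,
      X v - X u = (∫ r in u..v, b (X r)) + (γ v - γ u) := fun u hu v hv =>
    integral_equation_sub hb hX hXe ⟨hs.1.trans hu.1, hu.2.trans htT⟩
      ⟨hs.1.trans hv.1, hv.2.trans htT⟩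
  have hba : ∀ y ∈ Set.Icc m M, b y = a y := fun y hy =>
    (hbM y ⟨hKm.trans hy.1, hy.2⟩).trans (hK y (hKm.trans hy.1))
  -- The first grid time after `s`: the path is then still below `m + 2`, hence below the reference
  -- solution started there.
  set k := ⌈s * p⌉₊ with hk
  have hks : s ≤ k / p := (le_div_iff₀ hp0).2 (Nat.le_ceil _)
  have hks' : k / p < s + 1 / p := by
    rw [div_lt_iff₀ hp0, add_mul, one_div_mul_cancel hp0.ne']
    exact Nat.ceil_lt_add_one (mul_nonneg hs.1 hp0.le)
  have hkT : k ≤ ⌈T * p⌉₊ := Nat.ceil_mono (by gcongr; exact hs.2.trans htT)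
  have hsmall : ∀ w, w ≤ t → w ≤ k / p → ∀ u ∈ Set.Icc s w, X u < m + 2 := by
    intro w hwt hwk
    refine lt_add_two_of_small_time hX hXs (fun u hu => hgt u ⟨hu.1, hu.2.trans hwt⟩)
      (fun u hu => hinc s ⟨le_rfl, hs.2⟩ u ⟨hu.1, hu.2.trans hwt⟩) (c := c)
      (fun y hy => by rw [hba y ⟨hy.1, by linarith [hy.2]⟩]; exact hc y hy) (fun u hu => ?_)
    have hus : u - s < 1 / p := by linarith [hu.2]
    have h1 : c * (u - s) < 1 := by
      have : c * (u - s) ≤ p * (u - s) := by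
        gcongr
        linarith [hu.1]
      have : p * (u - s) < p * (1 / p) := by gcongr
      rw [mul_one_div_cancel hp0.ne'] at this
      linarith
    have h2 : γ u - γ s < 1 := by
      refine (le_abs_self _).trans_lt (hd u ⟨hs.1.trans hu.1, (hu.2.trans hwt).trans htT⟩ s
        ⟨hs.1, hs.2.trans htT⟩ ?_)
      rw [Real.dist_eq, abs_of_nonneg (by linarith [hu.1])]
      refine hus.trans ?_
      rw [div_lt_iff₀ hp0]
      rwa [div_lt_iff₀ hd0, mul_comm] at hp1
    linarith
  have hkt : k / p ≤ t := by
    by_contra! hh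
    have := hsmall t le_rfl hh.le t ⟨hs.2, le_rfl⟩
    linarith
  have hq0 : (0 : ℝ) ≤ k / p := by positivity
  have hqc : (((k : ℚ) / p : ℚ) : ℝ) = k / p := by push_cast; rfl
  have hZe' := hZe k
  rw [hqc] at hZe'
  have hZq : Z k (k / p) = N := by rw [hZe' _ le_rfl]; simp
  have hZc : ∀ u v, IntervalIntegrable (fun s => a (Z k s)) volume u v :=
    (ha.comp (hZ k)).intervalIntegrable
  have hfin : X t ≤ Z k t := by
    refine le_of_le_initial ha hL hX (hZ k) (q := k / p) (t := t) (γ := γ)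
      ?_ (fun u hu v hv => hinc u ⟨hks.trans hu.1, hu.2⟩ v ⟨hks.trans hv.1, hv.2⟩) ?_ ?_ hkt
    · rw [hZq]
      exact ((hsmall _ hkt le_rfl _ ⟨hks, le_rfl⟩).trans hN).le
    · intro u hu v hv
      rw [hZe' u hu.1, hZe' v hv.1,
        ← intervalIntegral.integral_add_adjacent_intervals (hZc (k / p) u) (hZc u v)]
      ring
    · intro u hu
      rcases (hks.trans hu.1).lt_or_eq with hsu | hsu
      · refine hba _ ⟨(hgt u ⟨hsu, hu.2⟩).le, ?_⟩
        by_cases hut : u = t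
        · rw [hut, hXtM]
        · exact (hlt u ⟨hq0.trans hu.1, hu.2⟩ hut).le
      · rw [← hsu, hXsm]
        exact hba m ⟨le_rfl, by linarith⟩
  have := (le_abs_self _).trans (hC k t ⟨ht.1, htT⟩)
  have := hMC k hkT
  linarith

/-- The drift `a` frozen outside `[-n, n]`. -/
def truncate (a : ℝ → ℝ) (n : ℕ) (y : ℝ) : ℝ := a (max (-n) (min n y))

theorem clamp_mem (n : ℕ) (y : ℝ) : max (-n : ℝ) (min n y) ∈ Set.Icc (-n : ℝ) n :=
  ⟨le_max_left _ _, max_le (by linarith [Nat.cast_nonneg (α := ℝ) n]) (min_le_left _ _)⟩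

theorem continuous_truncate {a : ℝ → ℝ} (ha : Continuous a) (n : ℕ) :
    Continuous (truncate a n) := by
  unfold truncate
  fun_prop

theorem truncate_eq {a : ℝ → ℝ} {n : ℕ} {y : ℝ} (hy : |y| ≤ n) : truncate a n y = a y := by
  rw [abs_le] at hy
  rw [truncate, min_eq_right hy.2, max_eq_right hy.1]

theorem exists_bound_truncate {a : ℝ → ℝ} (ha : Continuous a) (n : ℕ) :
    ∃ C, ∀ y, |truncate a n y| ≤ C := by
  obtain ⟨C, hC⟩ := (isCompact_Icc (a := (-n : ℝ)) (b := n)).exists_bound_of_continuousOn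
    ha.continuousOn
  exact ⟨C, fun y => hC _ (clamp_mem n y)⟩

theorem exists_lipschitz_truncate {a : ℝ → ℝ} (ha : LipschitzOnBounded a) (n : ℕ) :
    ∃ L, 0 ≤ L ∧ ∀ y z, |truncate a n y - truncate a n z| ≤ L * |y - z| := by
  obtain ⟨L, hL0, hL⟩ := ha n
  refine ⟨L, hL0, fun y z => (hL _ (clamp_mem n y) _ (clamp_mem n z)).trans
    (mul_le_mul_of_nonneg_left ?_ hL0)⟩
  refine (abs_max_sub_max_le_max _ _ _ _).trans (max_le ?_ ?_)
  · simp
  refine (abs_min_sub_min_le_max _ _ _ _).trans (max_le ?_ le_rfl)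
  simp

/-- The upper barrier is applied to the path and to its reflection. Since the barriers do not depend
on the drift within its class, a single `N` works for all truncation levels beyond it, and the
truncation is not felt before time `T`. -/
theorem exists_bound_of_solvable {a₁ a γ : ℝ → ℝ} (ha₁ : Continuous a₁) (ha : Continuous a)
    (hL : LipschitzOnBounded a) (hγ : Continuous γ) (h : SolvableFromRational a γ) (K T : ℝ)
    (hK : ∀ y, K ≤ |y| → a₁ y = a y) :
    ∃ N : ℕ, ∀ n : ℕ, N ≤ n → ∀ X : ℝ → ℝ, Continuous X →
      (∀ t ∈ Set.Icc 0 T, X t = γ t + ∫ s in (0 : ℝ)..t, truncate a₁ n (X s)) →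
      ∀ t ∈ Set.Icc 0 T, |X t| ≤ n := by
  have hK0 : ∀ y, max K 0 ≤ y → a₁ y = a y := fun y hy =>
    hK y ((le_max_left K 0).trans (hy.trans (le_abs_self y)))
  obtain ⟨M₁, hM₁⟩ := exists_upper_barrier ha hL hγ h (max K 0) T hK0
  have hL' : LipschitzOnBounded fun y => -a (-y) := fun R => by
    obtain ⟨L, hL0, hL⟩ := hL R
    refine ⟨L, hL0, fun y hy z hz => ?_⟩
    have := hL (-y) ⟨by linarith [hy.2], by linarith [hy.1]⟩ (-z)
      ⟨by linarith [hz.2], by linarith [hz.1]⟩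
    rwa [neg_sub_neg, abs_sub_comm z y, abs_sub_comm (a (-y)), ← neg_sub_neg (a (-y))] at this
  obtain ⟨M₂, hM₂⟩ := exists_upper_barrier (a₁ := fun y => -a₁ (-y)) (a := fun y => -a (-y))
    (by fun_prop) hL' hγ.neg h.reflect (max K 0) T (fun y hy => by
      rw [hK (-y) (by rw [abs_neg]; exact (le_max_left K 0).trans (hy.trans (le_abs_self y)))])
  obtain ⟨N, hN⟩ := exists_nat_ge (max M₁ M₂)
  refine ⟨N, fun n hn X hX hXe t ht => ?_⟩
  have hnN : (N : ℝ) ≤ n := by exact_mod_cast hn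
  have h1 : X t < M₁ := by
    refine hM₁ (truncate a₁ n) (continuous_truncate ha₁ n) (fun y hy => truncate_eq ?_) X hX hXe t ht
    rw [abs_of_nonneg ((le_max_right K 0).trans hy.1)]
    exact hy.2.trans ((le_max_left _ _).trans (hN.trans hnN))
  have h2 : -X t < M₂ := by
    refine hM₂ (fun y => -truncate a₁ n (-y)) ?_ (fun y hy => ?_) (fun t => -X t) hX.neg
      (fun t ht => ?_) t ht
    · have := continuous_truncate ha₁ n
      fun_prop
    · rw [truncate_eq]
      rw [abs_neg, abs_of_nonneg ((le_max_right K 0).trans hy.1)]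
      exact hy.2.trans ((le_max_right _ _).trans (hN.trans hnN))
    · simp only [neg_neg, intervalIntegral.integral_neg, hXe t ht, Pi.neg_apply]
      ring
  rw [abs_le]
  have := le_max_left M₁ M₂
  have := le_max_right M₁ M₂
  constructor <;> linarith

/-- The solutions of the truncated equations are eventually equal to a global solution. -/
theorem exists_global_solution {a₁ a γ : ℝ → ℝ} (ha₁ : Continuous a₁)
    (hL₁ : LipschitzOnBounded a₁) (ha : Continuous a)
    (hL : LipschitzOnBounded a) (hγ : Continuous γ) (h : SolvableFromRational a γ) (K : ℝ)
    (hK : ∀ y, K ≤ |y| → a₁ y = a y) {Y : ℕ → ℝ → ℝ} (hY : ∀ n, Continuous (Y n))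
    (hYe : ∀ n t, 0 ≤ t → Y n t = γ t + ∫ s in (0 : ℝ)..t, truncate a₁ n (Y n s)) :
    ∃ X : ℝ → ℝ, ContinuousOn X (Set.Ici 0) ∧
      (∀ t, 0 ≤ t → X t = γ t + ∫ s in (0 : ℝ)..t, a₁ (X s)) ∧
      ∀ t, 0 ≤ t → ∀ᶠ n in Filter.atTop, Y n t = X t := by
  choose N hN using fun T : ℝ => exists_bound_of_solvable ha₁ ha hL hγ h K T hK
  have hsol : ∀ T n, N T ≤ n → ∀ t ∈ Set.Icc 0 T, Y n t = γ t + ∫ s in (0 : ℝ)..t, a₁ (Y n s) := by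
    intro T n hn t ht
    rw [hYe n t ht.1]
    refine congrArg (γ t + ·) (intervalIntegral.integral_congr fun s hs => truncate_eq ?_)
    rw [Set.uIcc_of_le ht.1] at hs
    exact hN T n hn (Y n) (hY n) (fun t ht => hYe n t ht.1) s ⟨hs.1, hs.2.trans ht.2⟩
  have heq : ∀ T m n, N T ≤ m → N T ≤ n → ∀ t ∈ Set.Icc 0 T, Y m t = Y n t :=
    fun T m n hm hn => eq_of_integral_equation ha₁ hL₁ (hY m) (hY n) (hsol T m hm) (hsol T n hn)
  have hX : ∀ T n, N T ≤ n → ∀ t ∈ Set.Icc 0 T, Y (N t) t = Y n t := fun T n hn t ht =>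
    (heq t (N t) (max (N t) n) le_rfl (le_max_left _ _) t ⟨ht.1, le_rfl⟩).trans
      (heq T (max (N t) n) n (hn.trans (le_max_right _ _)) hn t ht)
  refine ⟨fun t => Y (N t) t, fun t ht => ?_, fun t ht => ?_, fun t ht => ?_⟩
  -- The index `N (t + 1)` is valid on a neighbourhood of `t` in `[0, ∞)`, whereas `N t` only covers
  -- times up to `t`.
  · refine ((hY (N (t + 1))).continuousAt.continuousWithinAt (s := Set.Ici 0)).congr_of_eventuallyEq
      ?_ (hX (t + 1) _ le_rfl t ⟨ht, by linarith⟩)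
    filter_upwards [self_mem_nhdsWithin,
      mem_nhdsWithin_of_mem_nhds (Iio_mem_nhds (show t < t + 1 by linarith))] with s hs hs'
    exact hX (t + 1) _ le_rfl s ⟨hs, le_of_lt hs'⟩
  · refine (hsol t (N t) le_rfl t ⟨ht, le_rfl⟩).trans
      (congrArg (γ t + ·) (intervalIntegral.integral_congr fun s hs => ?_))
    rw [Set.uIcc_of_le ht] at hs
    simp only [hX t (N t) le_rfl s hs]
  · filter_upwards [Filter.eventually_ge_atTop (N t)] with n hn
    exact (hX t n hn t ⟨ht, le_rfl⟩).symm

/-! ### Adaptedness and strong solutions. -/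

/-- Clamping the time variable to `[0, t]` gives a jointly measurable integrand using only
measurability at times up to `t`; this is what lets the integral be measurable for the sigma-algebra
at time `t`. -/
theorem measurable_intervalIntegral_of_continuous {Ω : Type*} [MeasurableSpace Ω]
    {u : ℝ → Ω → ℝ} {t : ℝ} (ht : 0 ≤ t) (hc : ∀ w, Continuous fun s => u s w)
    (hm : ∀ s ∈ Set.Icc 0 t, Measurable (u s)) :
    Measurable fun w => ∫ s in (0 : ℝ)..t, u s w := by
  have hclamp : ∀ s, max 0 (min s t) ∈ Set.Icc 0 t := fun s =>
    ⟨le_max_left _ _, max_le ht (min_le_right _ _)⟩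
  have heq : (fun w => ∫ s in (0 : ℝ)..t, u s w) =
      fun w => ∫ s in Set.Ioc 0 t, u (max 0 (min s t)) w := by
    ext w
    rw [intervalIntegral.integral_of_le ht]
    refine setIntegral_congr_fun measurableSet_Ioc fun s hs => ?_
    simp only [min_eq_left hs.2, max_eq_right hs.1.le]
  rw [heq]
  have := measurable_uncurry_of_continuous_of_measurable (u := fun s w => u (max 0 (min s t)) w)
    (fun w => (hc w).comp (by fun_prop)) (fun s => hm _ (hclamp s))
  exact this.stronglyMeasurable.integral_prod_left.measurable

theorem measurable_picardIterate {Ω : Type*} {F : ℝ≥0 → MeasurableSpace Ω} (hF : Monotone F)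
    {b : ℝ → ℝ} (hb : Continuous b) {γ : Ω → ℝ → ℝ} (hγ : ∀ w, Continuous (γ w))
    (hm : ∀ t : ℝ≥0, Measurable[F t] fun w => γ w t) (k : ℕ) :
    ∀ t : ℝ≥0, Measurable[F t] fun w => picardIterate b (γ w) k t := by
  induction k with
  | zero => exact hm
  | succ k ih =>
    intro t
    refine Measurable.add (hm t) ?_
    let _ := F t
    refine measurable_intervalIntegral_of_continuous t.2
      (fun w => hb.comp (continuous_picardIterate hb (hγ w) k)) (fun s hs => ?_)
    have := (ih ⟨s, hs.1⟩).mono (hF (show (⟨s, hs.1⟩ : ℝ≥0) ≤ t from hs.2)) le_rfl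
    exact hb.measurable.comp this

theorem monotone_augmentedFiltration {Ω : Type} [MeasurableSpace Ω] (P : Measure Ω)
    (B : ℝ≥0 → Ω → ℝ) : Monotone (augmentedFiltration P B) := by
  intro s t hst
  refine sup_le_sup_right (iSup_le fun r => ?_) _
  exact le_iSup (fun r : Set.Iic t => MeasurableSpace.comap (B r) (borel ℝ)) ⟨r, r.2.trans hst⟩

theorem measurable_augmentedFiltration {Ω : Type} [MeasurableSpace Ω] (P : Measure Ω)
    (B : ℝ≥0 → Ω → ℝ) (t : ℝ≥0) : Measurable[augmentedFiltration P B t] (B t) := by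
  rw [measurable_iff_comap_le]
  refine le_sup_of_le_left ?_
  rw [BorelSpace.measurable_eq (α := ℝ)]
  exact le_iSup (fun r : Set.Iic t => MeasurableSpace.comap (B r) (borel ℝ)) ⟨t, le_refl t⟩

theorem measurableSet_augmentedFiltration {Ω : Type} [MeasurableSpace Ω] {P : Measure Ω}
    (B : ℝ≥0 → Ω → ℝ) (t : ℝ≥0) {S : Set Ω} (hS : ∀ᵐ w ∂P, w ∈ S) :
    MeasurableSet[augmentedFiltration P B t] S := by
  have h : MeasurableSet[augmentedFiltration P B t] Sᶜ :=
    (le_sup_right : MeasurableSpace.generateFrom {N : Set Ω | P N = 0} ≤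
      augmentedFiltration P B t) _ (MeasurableSpace.measurableSet_generateFrom hS)
  exact h.of_compl

/-- After a time `q` the increments of a Brownian motion again form one, so the equation can be
restarted. Rational times and integer positions are countable, so one null set suffices. -/
theorem ae_solvableFromRational {W : ℝ → ℝ} (h : ∀ x₀, HasUniqueStrongSolution W x₀)
    {Ω : Type} [MeasurableSpace Ω] {P : Measure Ω} [IsProbabilityMeasure P]
    {B : ℝ≥0 → Ω → ℝ} (hB : IsBrownianReal B P) (x₀ : ℝ) :
    ∀ᵐ w ∂P, SolvableFromRational (fun y => -deriv W y) (fun s => x₀ + √2 * B s.toNNReal w) := by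
  refine ae_all_iff.2 fun q => ae_all_iff.2 fun n => ?_
  by_cases hq : 0 ≤ q
  swap
  · exact Filter.Eventually.of_forall fun w hq' => absurd hq' hq
  have hq' : (0 : ℝ) ≤ q := by exact_mod_cast hq
  obtain ⟨⟨X, hX⟩, -⟩ := h n Ω _ P inferInstance _ (hB.shift (q : ℝ).toNNReal)
  filter_upwards [hX.continuous, hX.equation] with w hc he _
  refine ⟨fun u => X (u - q).toNNReal w, hc.comp (by fun_prop), fun u hu => ?_⟩
  have hu' : 0 ≤ u - q := sub_nonneg.2 hu
  simp only []
  rw [intervalIntegral.integral_comp_sub_right (fun s => -deriv W (X s.toNNReal w)) (q : ℝ),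
    he, Real.coe_toNNReal _ hu', sub_self, ← Real.toNNReal_add hq' hu', add_sub_cancel,
    intervalIntegral.integral_neg]
  ring

/-- Strong well-posedness does not depend on the values of the drift in a bounded region. -/
theorem hasUniqueStrongSolution_of_deriv_eq {W W₁ : ℝ → ℝ} (hW : ContDiff ℝ ∞ W)
    (hW₁ : ContDiff ℝ ∞ W₁) {K : ℝ} (hK : ∀ y, K ≤ |y| → deriv W₁ y = deriv W y)
    (h : ∀ x₀, HasUniqueStrongSolution W x₀) (x₀ : ℝ) : HasUniqueStrongSolution W₁ x₀ := by
  intro Ω _ P _ B hB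
  have hd : ∀ {W : ℝ → ℝ}, ContDiff ℝ ∞ W → ContDiff ℝ 1 fun y => -deriv W y := fun hW =>
    (((contDiff_infty_iff_deriv.1 hW).2).of_le (by norm_cast)).neg
  have ha := (hd hW).continuous
  have hL := lipschitzOnBounded_of_contDiff (hd hW)
  have ha₁ := (hd hW₁).continuous
  have hL₁ := lipschitzOnBounded_of_contDiff (hd hW₁)
  constructor
  -- The good event need not be measurable originally, but its complement is null, so it belongs to
  -- the augmented sigma-algebra at every time.
  · set S : Set Ω := {w | Continuous (fun t => B t w) ∧
      SolvableFromRational (fun y => -deriv W y) (fun s => x₀ + √2 * B s.toNNReal w)} with hS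
    have hSae : ∀ᵐ w ∂P, w ∈ S := hB.cont.and (ae_solvableFromRational h hB x₀)
    set F := augmentedFiltration P B
    have hSm : ∀ t, MeasurableSet[F t] S := fun t => measurableSet_augmentedFiltration B t hSae
    -- Off `S` the noise is set to zero, so every path is continuous and the Picard construction
    -- applies for every `w`.
    set γ : Ω → ℝ → ℝ := fun w s => x₀ + √2 * S.indicator (B s.toNNReal) w with hγdef
    have hγS : ∀ w ∈ S, γ w = fun s => x₀ + √2 * B s.toNNReal w := fun w hw => by
      ext s
      simp [hγdef, hw]
    have hγ : ∀ w, Continuous (γ w) := fun w => by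
      by_cases hw : w ∈ S
      · rw [hγS w hw]
        have := hw.1
        fun_prop
      · simp only [hγdef, Set.indicator_of_notMem hw]
        fun_prop
    have hγm : ∀ t : ℝ≥0, Measurable[F t] fun w => γ w t := fun t => by
      have key : ∀ m : MeasurableSpace Ω, Measurable[m] (B t) → MeasurableSet[m] S →
          Measurable[m] fun w => x₀ + √2 * S.indicator (B t) w := fun m hm hSt =>
        ((hm.indicator hSt).const_mul _).const_add _
      simpa only [hγdef, Real.toNNReal_coe] using
        key _ (measurable_augmentedFiltration P B t) (hSm t)
    have hex : ∀ (n : ℕ) (w : Ω), ∃ X : ℝ → ℝ, Continuous X ∧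
        (∀ t, 0 ≤ t → Filter.Tendsto
          (fun k => picardIterate (truncate (fun y => -deriv W₁ y) n) (γ w) k t)
          Filter.atTop (nhds (X t))) ∧
        ∀ t, 0 ≤ t → X t = γ w t + ∫ s in (0 : ℝ)..t, truncate (fun y => -deriv W₁ y) n (X s) := by
      intro n w
      obtain ⟨C, hC⟩ := exists_bound_truncate ha₁ n
      obtain ⟨L, hL0, hL⟩ := exists_lipschitz_truncate hL₁ n
      exact exists_tendsto_picardIterate (continuous_truncate ha₁ n) (hγ w) hC hL0 hL
    choose Y hYc hYt hYe using hex
    have hYm : ∀ n (t : ℝ≥0), Measurable[F t] fun w => Y n w t := fun n t => by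
      have hm := fun k => measurable_picardIterate
        (monotone_augmentedFiltration P B) (continuous_truncate ha₁ n) hγ hγm k t
      exact @measurable_of_tendsto_metrizable _ _ (F t) _ _ _ _ _ _ hm
        (tendsto_pi_nhds.2 fun w => hYt n w t t.2)
    have hsol : ∀ w ∈ S, ∃ X : ℝ → ℝ, ContinuousOn X (Set.Ici 0) ∧
        (∀ t, 0 ≤ t → X t = γ w t + ∫ s in (0 : ℝ)..t, -deriv W₁ (X s)) ∧
        ∀ t, 0 ≤ t → ∀ᶠ n in Filter.atTop, Y n w t = X t := fun w hw =>
      exists_global_solution ha₁ hL₁ ha hL (hγ w) ((hγS w hw) ▸ hw.2) K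
        (fun y hy => by rw [hK y hy]) (fun n => hYc n w) (fun n => hYe n w)
    classical
    choose! X hXc hXe hXY using hsol
    refine ⟨fun t => S.indicator fun w => X w t, fun t => ?_, ?_, ?_⟩
    · refine @measurable_of_tendsto_metrizable _ _ (F t) _ _ _ _ _ _
        (fun n => (hYm n t).indicator (hSm t))
        (tendsto_pi_nhds.2 fun w => ?_)
      by_cases hw : w ∈ S
      · simp only [Set.indicator_of_mem hw]
        exact tendsto_const_nhds.congr' ((hXY w hw t t.2).mono fun n hn => hn.symm)
      · simp only [Set.indicator_of_notMem hw]
        exact tendsto_const_nhds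
    · filter_upwards [hSae] with w hw
      simp only [Set.indicator_of_mem hw]
      exact (hXc w hw).comp_continuous NNReal.continuous_coe fun t => t.2
    · filter_upwards [hSae] with w hw t
      simp only [Set.indicator_of_mem hw]
      rw [hXe w hw t t.2, hγS w hw, intervalIntegral.integral_neg]
      have : ∫ s in (0 : ℝ)..t, deriv W₁ (X w s) =
          ∫ s in (0 : ℝ)..t, deriv W₁ (X w s.toNNReal) :=
        intervalIntegral.integral_congr fun s hs => by
          rw [Set.uIcc_of_le t.coe_nonneg] at hs
          simp only [Real.coe_toNNReal _ hs.1]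
      simp only [this, Real.toNNReal_coe]
      ring
  · intro X Y hX hY
    filter_upwards [hX.continuous, hX.equation, hY.continuous, hY.equation] with w hXc hXe hYc hYe t
    have key : ∀ {X : ℝ≥0 → Ω → ℝ}, (∀ t : ℝ≥0, X t w = x₀ -
        (∫ s in (0 : ℝ)..t, deriv W₁ (X s.toNNReal w)) + √2 * B t w) →
        ∀ u ∈ Set.Icc (0 : ℝ) t, X u.toNNReal w = (x₀ + √2 * B u.toNNReal w) +
          ∫ s in (0 : ℝ)..u, -deriv W₁ (X s.toNNReal w) := fun hXe u hu => by
      rw [hXe, Real.coe_toNNReal _ hu.1, intervalIntegral.integral_neg]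
      ring
    have := eq_of_integral_equation ha₁ hL₁ (X := fun s => X s.toNNReal w)
      (Y := fun s => Y s.toNNReal w) (γ := fun s => x₀ + √2 * B s.toNNReal w) (T := t)
      (hXc.comp (by fun_prop)) (hYc.comp (by fun_prop)) (key hXe) (key hYe) t ⟨t.2, le_rfl⟩
    simpa using this

/-! ### Weak derivatives -/

theorem continuous_deriv_of_smoothCompact {ψ : ℝ → ℝ} (hψ : ψ ∈ smoothCompact) :
    Continuous (deriv ψ) :=
  hψ.1.continuous_deriv (by norm_cast)

theorem hasDerivAt_of_smoothCompact {ψ : ℝ → ℝ} (hψ : ψ ∈ smoothCompact) (x : ℝ) :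
    HasDerivAt ψ (deriv ψ x) x :=
  (hψ.1.differentiable (by norm_cast)).differentiableAt.hasDerivAt

theorem integrable_mul_of_locallyIntegrable {φ ψ : ℝ → ℝ} (hφ : LocallyIntegrable φ)
    (hψ : Continuous ψ) (hc : HasCompactSupport ψ) : Integrable fun x => φ x * ψ x := by
  simpa [mul_comm] using hφ.integrable_smul_left_of_hasCompactSupport hψ hc

theorem integral_deriv_smoothCompact {ψ : ℝ → ℝ} (hψ : ψ ∈ smoothCompact) :
    ∫ x, deriv ψ x = 0 :=
  integral_eq_zero_of_hasDerivAt_of_integrable (hasDerivAt_of_smoothCompact hψ)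
    ((continuous_deriv_of_smoothCompact hψ).integrable_of_hasCompactSupport hψ.2.deriv)
    (hψ.1.continuous.integrable_of_hasCompactSupport hψ.2)

theorem hasWeakDeriv_of_hasDerivAt {φ g : ℝ → ℝ} (h : ∀ x, HasDerivAt φ (g x) x)
    (hg : Continuous g) : HasWeakDeriv φ g := by
  have hφ : Continuous φ := continuous_iff_continuousAt.2 fun x => (h x).continuousAt
  refine ⟨hφ.locallyIntegrable, hg.locallyIntegrable, fun ψ hψ => ?_⟩
  exact integral_mul_deriv_eq_deriv_mul_of_integrable (fun x _ => h x)
    (fun x _ => hasDerivAt_of_smoothCompact hψ x)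
    (integrable_mul_of_locallyIntegrable hφ.locallyIntegrable
      (continuous_deriv_of_smoothCompact hψ) hψ.2.deriv)
    (integrable_mul_of_locallyIntegrable hg.locallyIntegrable hψ.1.continuous hψ.2)
    (integrable_mul_of_locallyIntegrable hφ.locallyIntegrable hψ.1.continuous hψ.2)

theorem HasWeakDeriv.sub_const {φ g : ℝ → ℝ} (h : HasWeakDeriv φ g) (c : ℝ) :
    HasWeakDeriv (fun x => φ x - c) g := by
  refine ⟨h.locallyIntegrable.sub continuous_const.locallyIntegrable, h.locallyIntegrable_deriv,
    fun ψ hψ => ?_⟩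
  simp only [sub_mul]
  rw [integral_sub (integrable_mul_of_locallyIntegrable h.locallyIntegrable
    (continuous_deriv_of_smoothCompact hψ) hψ.2.deriv)
    (((continuous_deriv_of_smoothCompact hψ).integrable_of_hasCompactSupport
      hψ.2.deriv).const_mul c), integral_const_mul, integral_deriv_smoothCompact hψ,
    h.integral_eq ψ hψ]
  ring

/-- The primitive from `-∞` vanishes left of the support, and right of it because the total integral
is zero. -/
theorem exists_primitive_smoothCompact {ζ : ℝ → ℝ} (hζ : ζ ∈ smoothCompact)
    (h0 : ∫ x, ζ x = 0) : ∃ η ∈ smoothCompact, deriv η = ζ := by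
  obtain ⟨R, hR, hζR⟩ := hζ.2.exists_pos_le_norm
  have hint : Integrable ζ := hζ.1.continuous.integrable_of_hasCompactSupport hζ.2
  have hd : ∀ x, HasDerivAt (fun x => ∫ t in (0 : ℝ)..x, ζ t) (ζ x) x := fun x =>
    intervalIntegral.integral_hasDerivAt_right (hζ.1.continuous.intervalIntegrable _ _)
      (hζ.1.continuous.stronglyMeasurableAtFilter _ _) hζ.1.continuous.continuousAt
  have heq : ∀ x, ∫ t in Set.Iic x, ζ t =
      (∫ t in (0 : ℝ)..x, ζ t) + ∫ t in Set.Iic (0 : ℝ), ζ t := fun x => by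
    rw [← intervalIntegral.integral_Iic_sub_Iic hint.integrableOn hint.integrableOn]
    ring
  have hd' : ∀ x, HasDerivAt (fun x => ∫ t in Set.Iic x, ζ t) (ζ x) x := fun x => by
    rw [show (fun x => ∫ t in Set.Iic x, ζ t) =
      fun x => (∫ t in (0 : ℝ)..x, ζ t) + ∫ t in Set.Iic (0 : ℝ), ζ t from funext heq]
    exact (hd x).add_const _
  have hderiv : deriv (fun x => ∫ t in Set.Iic x, ζ t) = ζ := funext fun x => (hd' x).deriv
  refine ⟨fun x => ∫ t in Set.Iic x, ζ t, ⟨?_, ?_⟩, hderiv⟩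
  · rw [contDiff_infty_iff_deriv, hderiv]
    exact ⟨fun x => (hd' x).differentiableAt, hζ.1⟩
  · refine HasCompactSupport.of_support_subset_isCompact (isCompact_Icc (a := -R) (b := R))
      fun x hx => ?_
    by_contra hxR
    apply hx
    rw [Set.mem_Icc, not_and_or, not_le, not_le] at hxR
    rcases hxR with h | h
    · refine setIntegral_eq_zero_of_forall_eq_zero fun t ht => hζR t ?_
      rw [Real.norm_eq_abs, abs_of_neg (by linarith [Set.mem_Iic.1 ht])]
      linarith [Set.mem_Iic.1 ht]
    · simp only []
      rw [setIntegral_eq_integral_of_forall_compl_eq_zero (fun t ht => hζR t ?_), h0]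
      rw [Set.mem_Iic, not_le] at ht
      rw [Real.norm_eq_abs, abs_of_pos (by linarith)]
      linarith

/-- The lemma of du Bois-Reymond. -/
theorem ae_eq_const_of_weakDeriv_zero {φ : ℝ → ℝ} (hφ : LocallyIntegrable φ)
    (h : ∀ ψ ∈ smoothCompact, ∫ x, φ x * deriv ψ x = 0) : ∃ c : ℝ, ∀ᵐ x, φ x = c := by
  let b : ContDiffBump (0 : ℝ) := ⟨1, 2, one_pos, one_lt_two⟩
  set θ := b.normed volume with hθdef
  have hθ : θ ∈ smoothCompact := ⟨b.contDiff_normed, b.hasCompactSupport_normed⟩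
  have hθ1 : ∫ x, θ x = 1 := b.integral_normed
  have hθint : Integrable θ := b.integrable_normed
  refine ⟨∫ x, φ x * θ x, ?_⟩
  set c := ∫ x, φ x * θ x
  have hsub : LocallyIntegrable fun x => φ x - c := hφ.sub continuous_const.locallyIntegrable
  have := ae_eq_zero_of_integral_contDiff_smul_eq_zero hsub fun ψ hψ hψc => ?_
  · filter_upwards [this] with x hx using sub_eq_zero.1 hx
  have hψint : Integrable ψ := hψ.continuous.integrable_of_hasCompactSupport hψc
  have hφψ := integrable_mul_of_locallyIntegrable hφ hψ.continuous hψc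
  have hφθ := integrable_mul_of_locallyIntegrable hφ hθ.1.continuous hθ.2
  -- Subtracting a multiple of the normalized bump makes `ψ` integrate to zero, hence a derivative
  -- of a test function. This identifies the constant as `∫ φ θ`.
  obtain ⟨η, hη, hηd⟩ := exists_primitive_smoothCompact
    (ζ := fun x => ψ x - (∫ y, ψ y) * θ x)
    ⟨hψ.sub (contDiff_const.mul hθ.1), hψc.sub (hθ.2.mul_left)⟩
    (by rw [integral_sub hψint (hθint.const_mul _), integral_const_mul, hθ1]; ring)
  have h1 := h η hη
  rw [hηd] at h1
  have h2 : ∫ x, φ x * (ψ x - (∫ y, ψ y) * θ x) = (∫ x, φ x * ψ x) - (∫ y, ψ y) * c := by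
    rw [← integral_const_mul, ← integral_sub hφψ (hφθ.const_mul _)]
    congr with x
    ring
  have h3 : ∫ x, ψ x • (φ x - c) = (∫ x, φ x * ψ x) - c * ∫ y, ψ y := by
    rw [← integral_const_mul, ← integral_sub hφψ (hψint.const_mul _)]
    congr with x
    simp only [smul_eq_mul]
    ring
  rw [h3]
  linarith

/-! ### Gibbs measures -/

section Gibbs

variable {W : ℝ → ℝ}

theorem partition_pos (hW : Integrable fun x => Real.exp (-W x)) : 0 < partition W :=
  integral_exp_pos hW

theorem isProbabilityMeasure_gibbs (hW : Integrable fun x => Real.exp (-W x)) :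
    IsProbabilityMeasure (gibbs W) :=
  isProbabilityMeasure_tilted hW

theorem integral_gibbs (W g : ℝ → ℝ) :
    ∫ x, g x ∂(gibbs W) = (∫ x, g x * Real.exp (-W x)) / partition W := by
  rw [gibbs, integral_tilted, ← integral_div]
  congr with x
  simp only [smul_eq_mul, partition]
  ring

theorem integrable_gibbs_iff (hW : Integrable fun x => Real.exp (-W x)) (g : ℝ → ℝ) :
    Integrable g (gibbs W) ↔ Integrable fun x => g x * Real.exp (-W x) := by
  rw [gibbs, integrable_tilted_iff hW]
  simp [mul_comm]

theorem gibbs_absolutelyContinuous (W : ℝ → ℝ) : gibbs W ≪ volume :=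
  tilted_absolutelyContinuous _ _

theorem memLp_two_gibbs_iff (hW : Integrable fun x => Real.exp (-W x)) {g : ℝ → ℝ}
    (hg : AEStronglyMeasurable g) :
    MemLp g 2 (gibbs W) ↔ Integrable fun x => g x ^ 2 * Real.exp (-W x) := by
  rw [memLp_two_iff_integrable_sq (hg.mono_ac (gibbs_absolutelyContinuous W)),
    integrable_gibbs_iff hW]

theorem memH1_gibbs_iff (hW : Integrable fun x => Real.exp (-W x)) {φ g : ℝ → ℝ} :
    MemH1 (gibbs W) φ g ↔ HasWeakDeriv φ g ∧ (Integrable fun x => φ x ^ 2 * Real.exp (-W x)) ∧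
      Integrable fun x => g x ^ 2 * Real.exp (-W x) := by
  refine ⟨fun h => ⟨h.1, ?_, ?_⟩, fun h => ⟨h.1, ?_, ?_⟩⟩
  · exact (memLp_two_gibbs_iff hW h.1.1.aestronglyMeasurable).1 h.2
  · exact (memLp_two_gibbs_iff hW h.1.2.aestronglyMeasurable).1 h.3
  · exact (memLp_two_gibbs_iff hW h.1.1.aestronglyMeasurable).2 h.2.1
  · exact (memLp_two_gibbs_iff hW h.1.2.aestronglyMeasurable).2 h.2.2

theorem satisfiesPoincare_gibbs_iff (hW : Integrable fun x => Real.exp (-W x)) :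
    SatisfiesPoincare (gibbs W) ↔ ∃ C : ℝ, 0 < C ∧ ∀ φ g : ℝ → ℝ, HasWeakDeriv φ g →
      (Integrable fun x => φ x ^ 2 * Real.exp (-W x)) →
      (Integrable fun x => g x ^ 2 * Real.exp (-W x)) → ∫ x, φ x * Real.exp (-W x) = 0 →
      ∫ x, φ x ^ 2 * Real.exp (-W x) ≤ C * ∫ x, g x ^ 2 * Real.exp (-W x) := by
  have hZ := partition_pos hW
  have key : ∀ (C : ℝ) (φ g : ℝ → ℝ), (∫ x, φ x ^ 2 ∂(gibbs W) ≤ C * ∫ x, g x ^ 2 ∂(gibbs W)) ↔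
      ∫ x, φ x ^ 2 * Real.exp (-W x) ≤ C * ∫ x, g x ^ 2 * Real.exp (-W x) := fun C φ g => by
    rw [integral_gibbs, integral_gibbs, ← mul_div_assoc, div_le_div_iff_of_pos_right hZ]
  have hzero : ∀ φ : ℝ → ℝ, ∫ x, φ x ∂(gibbs W) = 0 ↔ ∫ x, φ x * Real.exp (-W x) = 0 := fun φ => by
    rw [integral_gibbs, div_eq_zero_iff, or_iff_left hZ.ne']
  constructor
  · rintro ⟨R, hR, h⟩
    exact ⟨1 / R, by positivity, fun φ g h1 h2 h3 h4 =>
      (key _ _ _).1 (h φ g ((memH1_gibbs_iff hW).2 ⟨h1, h2, h3⟩) ((hzero φ).2 h4))⟩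
  · rintro ⟨C, hC, h⟩
    refine ⟨1 / C, by positivity, fun φ g h1 h4 => ?_⟩
    obtain ⟨h1, h2, h3⟩ := (memH1_gibbs_iff hW).1 h1
    rw [key, one_div_one_div]
    exact h φ g h1 h2 h3 ((hzero φ).1 h4)

theorem integrable_mul_exp_of_sq (hW : Integrable fun x => Real.exp (-W x)) {φ : ℝ → ℝ}
    (hφ : AEStronglyMeasurable φ) (h : Integrable fun x => φ x ^ 2 * Real.exp (-W x)) :
    Integrable fun x => φ x * Real.exp (-W x) := by
  refine (h.add hW).mono' (hφ.mul hW.aestronglyMeasurable) (Filter.Eventually.of_forall fun x => ?_)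
  simp only [Pi.add_apply, norm_mul, Real.norm_eq_abs, Real.abs_exp]
  have := Real.exp_pos (-W x)
  nlinarith [sq_nonneg (|φ x| - 1), sq_abs (φ x), abs_nonneg (φ x)]

theorem integrable_mul_exp_add {U : ℝ → ℝ} (hU : Continuous U) {C : ℝ} (hC : ∀ x, |U x| ≤ C)
    {p : ℝ → ℝ} : (Integrable fun x => p x * Real.exp (-(W + U) x)) ↔
      Integrable fun x => p x * Real.exp (-W x) := by
  have aux : ∀ {W U : ℝ → ℝ}, Continuous U → (∀ x, |U x| ≤ C) →
      (Integrable fun x => p x * Real.exp (-W x)) →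
      Integrable fun x => p x * Real.exp (-(W + U) x) := by
    intro W U hU hC h
    have : (fun x => p x * Real.exp (-(W + U) x)) =
        fun x => Real.exp (-U x) * (p x * Real.exp (-W x)) := by
      ext x
      rw [Pi.add_apply, neg_add, Real.exp_add]
      ring
    rw [this]
    refine h.bdd_mul (c := Real.exp C) (by fun_prop : Continuous _).aestronglyMeasurable
      (Filter.Eventually.of_forall fun x => ?_)
    rw [Real.norm_eq_abs, Real.abs_exp, Real.exp_le_exp]
    exact (neg_le_abs _).trans (hC x)
  refine ⟨fun h => ?_, aux hU hC⟩
  have := aux (W := W + U) (U := -U) hU.neg (fun x => by simpa using hC x) h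
  simpa using this

/-- The Poincaré inequality is stable under bounded perturbations of the potential. -/
theorem SatisfiesPoincare.add_bounded (hW : Integrable fun x => Real.exp (-W x)) {U : ℝ → ℝ}
    (hU : Continuous U) {C : ℝ} (hC : ∀ x, |U x| ≤ C) (h : SatisfiesPoincare (gibbs W)) :
    SatisfiesPoincare (gibbs (W + U)) := by
  have hWU : Integrable fun x => Real.exp (-(W + U) x) := by
    simpa using (integrable_mul_exp_add (W := W) hU hC (p := fun _ => 1)).2 (by simpa using hW)
  obtain ⟨D, hD, h⟩ := (satisfiesPoincare_gibbs_iff hW).1 h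
  refine (satisfiesPoincare_gibbs_iff hWU).2 ⟨Real.exp C * D * Real.exp C, by positivity,
    fun φ g hφg hφ hg hφ0 => ?_⟩
  have hZ := partition_pos hW
  have hφ1 := integrable_mul_exp_of_sq hWU hφg.1.aestronglyMeasurable hφ
  have hφ' := (integrable_mul_exp_add hU hC).1 hφ
  have hg' := (integrable_mul_exp_add hU hC).1 hg
  have hφ1' := integrable_mul_exp_of_sq hW hφg.1.aestronglyMeasurable hφ'
  -- The mean under the unperturbed measure. Since `φ` is centred for the perturbed one, subtracting
  -- `c` can only increase its perturbed second moment, while it makes the original inequality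
  -- applicable.
  set c := (∫ x, φ x * Real.exp (-W x)) / partition W with hc
  have hexp : ∀ V : ℝ → ℝ, (fun x => (φ x - c) ^ 2 * Real.exp (-V x)) = fun x =>
      φ x ^ 2 * Real.exp (-V x) - 2 * c * (φ x * Real.exp (-V x)) + c ^ 2 * Real.exp (-V x) :=
    fun V => by ext x; ring
  have hi : Integrable fun x => (φ x - c) ^ 2 * Real.exp (-W x) := by
    rw [hexp]
    exact (hφ'.sub (hφ1'.const_mul _)).add (hW.const_mul _)
  have hi2 : Integrable fun x => (φ x - c) ^ 2 * Real.exp (-(W + U) x) :=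
    (integrable_mul_exp_add hU hC).2 hi
  have e1 : ∫ x, φ x ^ 2 * Real.exp (-(W + U) x) ≤
      ∫ x, (φ x - c) ^ 2 * Real.exp (-(W + U) x) := by
    rw [hexp, integral_add (f := fun x => φ x ^ 2 * Real.exp (-(W + U) x) -
      2 * c * (φ x * Real.exp (-(W + U) x))) (hφ.sub (hφ1.const_mul _)) (hWU.const_mul _),
      integral_sub hφ (hφ1.const_mul _), integral_const_mul, integral_const_mul, hφ0]
    have : 0 ≤ ∫ x, Real.exp (-(W + U) x) := integral_nonneg fun x => (Real.exp_pos _).le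
    nlinarith [mul_nonneg (sq_nonneg c) this]
  have e2 : ∫ x, (φ x - c) ^ 2 * Real.exp (-(W + U) x) ≤
      Real.exp C * ∫ x, (φ x - c) ^ 2 * Real.exp (-W x) := by
    rw [← integral_const_mul]
    refine integral_mono hi2 (hi.const_mul _) fun x => ?_
    simp only [Pi.add_apply, neg_add, Real.exp_add]
    have : Real.exp (-U x) ≤ Real.exp C := Real.exp_le_exp.2 ((neg_le_abs _).trans (hC x))
    have h0 : 0 ≤ (φ x - c) ^ 2 * Real.exp (-W x) := by positivity
    nlinarith [mul_le_mul_of_nonneg_left this h0]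
  have e3 : ∫ x, (φ x - c) ^ 2 * Real.exp (-W x) ≤ D * ∫ x, g x ^ 2 * Real.exp (-W x) := by
    refine h _ g (hφg.sub_const c) hi hg' ?_
    simp only [sub_mul]
    rw [integral_sub hφ1' (hW.const_mul c), integral_const_mul,
      show ∫ x, Real.exp (-W x) = partition W from rfl, hc, div_mul_cancel₀ _ hZ.ne', sub_self]
  have e4 : ∫ x, g x ^ 2 * Real.exp (-W x) ≤
      Real.exp C * ∫ x, g x ^ 2 * Real.exp (-(W + U) x) := by
    rw [← integral_const_mul]
    refine integral_mono hg' (hg.const_mul _) fun x => ?_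
    simp only [Pi.add_apply, neg_add, Real.exp_add]
    have : 1 ≤ Real.exp C * Real.exp (-U x) := by
      rw [← Real.exp_add, Real.one_le_exp_iff]
      linarith [(le_abs_self (U x)).trans (hC x)]
    have h0 : 0 ≤ g x ^ 2 * Real.exp (-W x) := by positivity
    nlinarith [mul_le_mul_of_nonneg_left this h0]
  calc _ ≤ _ := e1
    _ ≤ _ := e2
    _ ≤ Real.exp C * (D * (Real.exp C * ∫ x, g x ^ 2 * Real.exp (-(W + U) x))) := by
      gcongr
      exact e3.trans (by gcongr)
    _ = _ := by ring

end Gibbs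

theorem IsAdmissible.add_smoothCompact {V f U : ℝ → ℝ} (hV : ContDiff ℝ ∞ V)
    (hVint : Integrable fun x => Real.exp (-V x)) (hf : Continuous f) (h0 : IsAdmissible V f 0)
    (hU : U ∈ smoothCompact) : IsAdmissible V f U := by
  obtain ⟨C, hC⟩ := hU.2.exists_bound_of_continuous hU.1.continuous
  have hUc := hU.1.continuous
  have hint : Integrable fun x => Real.exp (-(V + U) x) := by
    simpa using (integrable_mul_exp_add (W := V) hUc hC (p := fun _ => 1)).2 (by simpa using hVint)
  refine ⟨hU.1, hint, ?_, ?_, fun x₀ => ?_⟩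
  · exact SatisfiesPoincare.add_bounded hVint hUc hC (by simpa using h0.poincare)
  · have hm := h0.memLp
    simp only [Pi.zero_apply, Real.exp_zero, mul_one, add_zero] at hm
    have hk : Integrable fun x => (f x - mean V f) ^ 2 * Real.exp (-V x) :=
      (memLp_two_gibbs_iff hVint (by fun_prop : Continuous _).aestronglyMeasurable).1 hm
    refine (memLp_two_gibbs_iff hint (by fun_prop : Continuous _).aestronglyMeasurable).2 ?_
    rw [integrable_mul_exp_add hUc hC]
    have : (fun x => ((f x - mean V f) * Real.exp (U x)) ^ 2 * Real.exp (-V x)) =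
        fun x => Real.exp (U x) ^ 2 * ((f x - mean V f) ^ 2 * Real.exp (-V x)) := by
      ext x; ring
    rw [this]
    refine hk.bdd_mul (c := Real.exp C ^ 2) (by fun_prop : Continuous _).aestronglyMeasurable
      (Filter.Eventually.of_forall fun x => ?_)
    rw [Real.norm_eq_abs, abs_of_nonneg (by positivity)]
    gcongr
    exact (le_abs_self _).trans (hC x)
  · obtain ⟨R, -, hR⟩ := hU.2.deriv.exists_pos_le_norm
    refine hasUniqueStrongSolution_of_deriv_eq hV (hV.add hU.1) (K := R) (fun y hy => ?_)
      (by simpa using h0.strongSolution) x₀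
    rw [deriv_fun_add (hV.differentiable (by norm_cast)).differentiableAt
      (hU.1.differentiable (by norm_cast)).differentiableAt, hR y hy, add_zero]

/-! ### Cutoffs and the energy estimate. -/

/-- The Cauchy-Schwarz inequality with a weight. -/
theorem sq_integral_mul_le {w f g : ℝ → ℝ} (hw : ∀ x, 0 ≤ w x)
    (hf : Integrable fun x => f x ^ 2 * w x) (hg : Integrable fun x => g x ^ 2 * w x)
    (hfg : Integrable fun x => f x * g x * w x) :
    (∫ x, f x * g x * w x) ^ 2 ≤ (∫ x, f x ^ 2 * w x) * ∫ x, g x ^ 2 * w x := by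
  have h : ∀ t : ℝ, 0 ≤ (∫ x, f x ^ 2 * w x) * (t * t) + (2 * ∫ x, f x * g x * w x) * t +
      ∫ x, g x ^ 2 * w x := fun t => by
    have e : ∫ x, (t * f x + g x) ^ 2 * w x = (∫ x, f x ^ 2 * w x) * (t * t) +
        (2 * ∫ x, f x * g x * w x) * t + ∫ x, g x ^ 2 * w x := by
      rw [← integral_mul_const, ← integral_const_mul, ← integral_mul_const,
        ← integral_add (hf.mul_const _) ((hfg.const_mul _).mul_const _),
        ← integral_add (f := fun x => f x ^ 2 * w x * (t * t) + 2 * (f x * g x * w x) * t)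
          ((hf.mul_const _).add ((hfg.const_mul _).mul_const _)) hg]
      congr with x
      ring
    rw [← e]
    exact integral_nonneg fun x => mul_nonneg (sq_nonneg _) (hw x)
  have := discrim_le_zero h
  rw [discrim] at this
  linarith

/-- A continuous cutoff, equal to `1` on `[-n, n]`. -/
def cutoff (n : ℕ) (x : ℝ) : ℝ := max 0 (min 1 (n + 1 - |x|))

theorem continuous_cutoff (n : ℕ) : Continuous (cutoff n) := by
  unfold cutoff
  fun_prop

theorem cutoff_mem (n : ℕ) (x : ℝ) : cutoff n x ∈ Set.Icc (0 : ℝ) 1 :=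
  ⟨le_max_left _ _, max_le zero_le_one (min_le_left _ _)⟩

theorem cutoff_eq_one {n : ℕ} {x : ℝ} (h : |x| ≤ n) : cutoff n x = 1 := by
  rw [cutoff, min_eq_left (by linarith), max_eq_right zero_le_one]

theorem hasCompactSupport_cutoff (n : ℕ) : HasCompactSupport (cutoff n) := by
  refine HasCompactSupport.intro (isCompact_Icc (a := -(n + 1 : ℝ)) (b := n + 1)) fun x hx => ?_
  rw [Set.mem_Icc, ← abs_le, not_le] at hx
  rw [cutoff, max_eq_left]
  exact (min_le_right _ _).trans (by linarith)

theorem eventually_cutoff_eq_one (x : ℝ) : ∀ᶠ n in Filter.atTop, cutoff n x = 1 := by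
  obtain ⟨N, hN⟩ := exists_nat_ge |x|
  filter_upwards [Filter.eventually_ge_atTop N] with n hn
  exact cutoff_eq_one (hN.trans (by exact_mod_cast hn))

theorem hasDerivAt_primitive {g : ℝ → ℝ} (hg : Continuous g) (x : ℝ) :
    HasDerivAt (fun x => ∫ t in (0 : ℝ)..x, g t) (g x) x :=
  intervalIntegral.integral_hasDerivAt_right (hg.intervalIntegrable _ _)
    (hg.stronglyMeasurableAtFilter _ _) hg.continuousAt

theorem exists_bound_primitive {g : ℝ → ℝ} (hg : Integrable g) :
    ∃ C, ∀ x, |∫ t in (0 : ℝ)..x, g t| ≤ C :=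
  ⟨∫ t, |g t|, fun x => by
    rw [← Real.norm_eq_abs]
    refine intervalIntegral.norm_integral_le_integral_norm_uIoc.trans ?_
    exact setIntegral_le_integral hg.norm (Filter.Eventually.of_forall fun t => norm_nonneg _)⟩

/-- Fatou's lemma. -/
theorem integrable_of_tendsto_of_integral_le {G : ℕ → ℝ → ℝ} {g : ℝ → ℝ} {C : ℝ}
    (hG : ∀ n, Integrable (G n)) (hG0 : ∀ n x, 0 ≤ G n x) (hC : ∀ n, ∫ x, G n x ≤ C)
    (hlim : ∀ x, Filter.Tendsto (fun n => G n x) Filter.atTop (nhds (g x))) : Integrable g := by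
  refine integrable_of_tendsto (Filter.Eventually.of_forall hlim) (fun n => (hG n).1) ?_
  refine ne_top_of_le_ne_top (ENNReal.ofReal_ne_top (r := C)) ?_
  refine Filter.liminf_le_of_frequently_le' (Filter.Eventually.of_forall fun n => ?_).frequently
  rw [← ofReal_integral_norm_eq_lintegral_enorm (hG n)]
  refine ENNReal.ofReal_le_ofReal ((le_of_eq ?_).trans (hC n))
  exact integral_congr_ae (Filter.Eventually.of_forall fun x => Real.norm_of_nonneg (hG0 n x))

section Energy

variable {W k H : ℝ → ℝ} {D : ℝ}

/-- Let `E` be the cut-off energy, `S = ∫ k² exp W`, and `v` the centred primitive of `-H exp W`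
times the cutoff. Integration by parts gives `E ≤ ∫ k v`; Cauchy-Schwarz and Poincaré give `E² ≤ S *
(D * E)`. The cutoff makes `E` finite beforehand, so dividing by it is legitimate, and the bounds do
not depend on `n`. -/
theorem energy_cutoff_le (hWc : Continuous W) (hW : Integrable fun x => Real.exp (-W x))
    (hD : 0 < D) (hP : ∀ φ g : ℝ → ℝ, HasWeakDeriv φ g →
      (Integrable fun x => φ x ^ 2 * Real.exp (-W x)) →
      (Integrable fun x => g x ^ 2 * Real.exp (-W x)) → ∫ x, φ x * Real.exp (-W x) = 0 →
      ∫ x, φ x ^ 2 * Real.exp (-W x) ≤ D * ∫ x, g x ^ 2 * Real.exp (-W x))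
    (hk : Integrable k) (hk2 : Integrable fun x => k x ^ 2 * Real.exp (W x))
    (hH : ∀ x, HasDerivAt H (k x) x) (hbot : Filter.Tendsto H Filter.atBot (nhds 0))
    (htop : Filter.Tendsto H Filter.atTop (nhds 0)) (n : ℕ) :
    (Integrable fun x => H x ^ 2 * Real.exp (W x) * cutoff n x ^ 2) ∧
    ∫ x, H x ^ 2 * Real.exp (W x) * cutoff n x ^ 2 ≤ D * ∫ x, k x ^ 2 * Real.exp (W x) ∧
    ∃ m, (Integrable fun x => ((∫ t in (0 : ℝ)..x, -(H t * Real.exp (W t)) * cutoff n t) - m) ^ 2 *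
        Real.exp (-W x)) ∧
      ∫ x, ((∫ t in (0 : ℝ)..x, -(H t * Real.exp (W t)) * cutoff n t) - m) ^ 2 *
        Real.exp (-W x) ≤ D * (D * ∫ x, k x ^ 2 * Real.exp (W x)) := by
  have hHc : Continuous H := continuous_iff_continuousAt.2 fun x => (hH x).continuousAt
  have hχ := continuous_cutoff n
  have hcs := hasCompactSupport_cutoff n
  have hcs2 : HasCompactSupport fun x => cutoff n x ^ 2 :=
    hcs.comp_left (g := fun y : ℝ => y ^ 2) (by norm_num)
  have hcomp : ∀ {p : ℝ → ℝ}, Continuous p → Integrable fun x => p x * cutoff n x := fun hp =>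
    (hp.mul hχ).integrable_of_hasCompactSupport hcs.mul_left
  have hcomp2 : ∀ {p : ℝ → ℝ}, Continuous p → Integrable fun x => p x * cutoff n x ^ 2 := fun hp =>
    (hp.mul (hχ.pow 2)).integrable_of_hasCompactSupport hcs2.mul_left
  set g : ℝ → ℝ := fun t => -(H t * Real.exp (W t)) * cutoff n t with hg
  have hgc : Continuous g := by fun_prop
  have hgi : Integrable g := hcomp (by fun_prop)
  set Φ : ℝ → ℝ := fun x => ∫ t in (0 : ℝ)..x, g t with hΦ
  obtain ⟨C, hC⟩ := exists_bound_primitive hgi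
  have hΦd : ∀ x, HasDerivAt Φ (g x) x := hasDerivAt_primitive hgc
  have hΦc : Continuous Φ := continuous_iff_continuousAt.2 fun x => (hΦd x).continuousAt
  have hΦi : Integrable fun x => Φ x * Real.exp (-W x) :=
    hW.bdd_mul hΦc.aestronglyMeasurable (Filter.Eventually.of_forall hC)
  have hZ := partition_pos hW
  set m := (∫ x, Φ x * Real.exp (-W x)) / partition W with hm
  set v : ℝ → ℝ := fun x => Φ x - m with hv
  have hvd : ∀ x, HasDerivAt v (g x) x := fun x => (hΦd x).sub_const m
  have hvc : Continuous v := hΦc.sub continuous_const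
  have hvC : ∀ x, ‖v x‖ ≤ C + |m| := fun x => by
    refine (norm_sub_le _ _).trans (add_le_add (hC x) le_rfl)
  have hv0 : ∫ x, v x * Real.exp (-W x) = 0 := by
    simp only [hv, sub_mul]
    rw [integral_sub hΦi (hW.const_mul _), integral_const_mul,
      show ∫ x, Real.exp (-W x) = partition W from rfl, hm, div_mul_cancel₀ _ hZ.ne', sub_self]
  have hv2 : Integrable fun x => v x ^ 2 * Real.exp (-W x) := by
    refine hW.bdd_mul (c := (C + |m|) ^ 2) (hvc.pow 2).aestronglyMeasurable
      (Filter.Eventually.of_forall fun x => ?_)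
    rw [norm_pow]
    gcongr
    exact hvC x
  have hgg : (fun x => g x ^ 2 * Real.exp (-W x)) =
      fun x => H x ^ 2 * Real.exp (W x) * cutoff n x ^ 2 := by
    ext x
    have : Real.exp (W x) * Real.exp (-W x) = 1 := by rw [← Real.exp_add]; simp
    simp only [hg]
    linear_combination H x ^ 2 * cutoff n x ^ 2 * Real.exp (W x) * this
  have hE : Integrable fun x => H x ^ 2 * Real.exp (W x) * cutoff n x ^ 2 := hcomp2 (by fun_prop)
  have hE1 : Integrable fun x => H x ^ 2 * Real.exp (W x) * cutoff n x := hcomp (by fun_prop)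
  have hkv : Integrable fun x => k x * v x := by
    simpa [mul_comm] using hk.bdd_mul hvc.aestronglyMeasurable (Filter.Eventually.of_forall hvC)
  have hlim : ∀ {l : Filter ℝ}, Filter.Tendsto H l (nhds 0) →
      Filter.Tendsto (H * v) l (nhds 0) := fun hl =>
    hl.zero_mul_isBoundedUnder_le (Filter.isBoundedUnder_of ⟨C + |m|, hvC⟩)
  have hparts : ∫ x, H x * g x = - ∫ x, k x * v x := by
    rw [integral_mul_deriv_eq_deriv_mul (u := H) (v := v) (u' := k) (v' := g) (fun x _ => hH x)
      (fun x _ => hvd x) ?_ hkv (hlim hbot) (hlim htop)]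
    · ring
    · have : H * g = fun x => -(H x ^ 2 * Real.exp (W x)) * cutoff n x := by
        ext x; simp only [Pi.mul_apply, hg]; ring
      rw [this]
      exact hcomp (by fun_prop)
  set E := ∫ x, H x ^ 2 * Real.exp (W x) * cutoff n x ^ 2 with hEdef
  set S := ∫ x, k x ^ 2 * Real.exp (W x) with hSdef
  have hE0 : 0 ≤ E := integral_nonneg fun x => by positivity
  have hS0 : 0 ≤ S := integral_nonneg fun x => by positivity
  have h1 : E ≤ ∫ x, k x * v x := by
    have : ∫ x, k x * v x = ∫ x, H x ^ 2 * Real.exp (W x) * cutoff n x := by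
      rw [← neg_eq_iff_eq_neg.2 hparts, ← integral_neg]
      congr with x
      simp only [hg]
      ring
    rw [this]
    refine integral_mono hE hE1 fun x => ?_
    have := cutoff_mem n x
    have h0 : 0 ≤ H x ^ 2 * Real.exp (W x) := by positivity
    simp only []
    gcongr
    nlinarith [this.1, this.2]
  have hee : ∀ x, Real.exp (W x) * Real.exp (-W x) = 1 := fun x => by
    rw [← Real.exp_add]; simp
  have hk2' : (fun x => (k x * Real.exp (W x)) ^ 2 * Real.exp (-W x)) =
      fun x => k x ^ 2 * Real.exp (W x) := by
    ext x
    linear_combination k x ^ 2 * Real.exp (W x) * hee x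
  have hkv' : (fun x => k x * Real.exp (W x) * v x * Real.exp (-W x)) = fun x => k x * v x := by
    ext x
    linear_combination k x * v x * hee x
  have h2 : (∫ x, k x * v x) ^ 2 ≤ S * ∫ x, v x ^ 2 * Real.exp (-W x) := by
    have := sq_integral_mul_le (w := fun x => Real.exp (-W x)) (f := fun x => k x * Real.exp (W x))
      (g := v) (fun x => (Real.exp_pos _).le) (by rw [hk2']; exact hk2) hv2
      (by rw [hkv']; exact hkv)
    rwa [hk2', hkv'] at this
  have h3 : ∫ x, v x ^ 2 * Real.exp (-W x) ≤ D * E := by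
    have := hP v g (hasWeakDeriv_of_hasDerivAt hvd hgc) hv2 (by rw [hgg]; exact hE) hv0
    rwa [hgg] at this
  have h4 : E ≤ D * S := by
    rcases hE0.eq_or_lt with h | h
    · rw [← h]; positivity
    · have h5 : E ^ 2 ≤ S * (D * E) :=
        (pow_le_pow_left₀ hE0 h1 2).trans (h2.trans (mul_le_mul_of_nonneg_left h3 hS0))
      nlinarith
  exact ⟨hE, h4, m, hv2, h3.trans (mul_le_mul_of_nonneg_left h4 hD.le)⟩

/-- The explicit solution of the one-dimensional Poisson equation has finite energy. -/
theorem integrable_sq_flux_and_primitive (hWc : Continuous W)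
    (hW : Integrable fun x => Real.exp (-W x)) (hP : SatisfiesPoincare (gibbs W))
    (hk : Integrable k) (hk2 : Integrable fun x => k x ^ 2 * Real.exp (W x))
    (hH : ∀ x, HasDerivAt H (k x) x) (hbot : Filter.Tendsto H Filter.atBot (nhds 0))
    (htop : Filter.Tendsto H Filter.atTop (nhds 0)) :
    (Integrable fun x => H x ^ 2 * Real.exp (W x)) ∧
    Integrable fun x => (∫ t in (0 : ℝ)..x, -(H t * Real.exp (W t))) ^ 2 * Real.exp (-W x) := by
  obtain ⟨D, hD, hP⟩ := (satisfiesPoincare_gibbs_iff hW).1 hP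
  have hHc : Continuous H := continuous_iff_continuousAt.2 fun x => (hH x).continuousAt
  have henergy := energy_cutoff_le hWc hW hD hP hk hk2 hH hbot htop
  refine ⟨integrable_of_tendsto_of_integral_le (fun n => (henergy n).1)
    (fun n x => by positivity) (fun n => (henergy n).2.1) fun x => ?_, ?_⟩
  · refine tendsto_const_nhds.congr' ((eventually_cutoff_eq_one x).mono fun n hn => ?_)
    simp only [hn, one_pow, mul_one]
  set S := ∫ x, k x ^ 2 * Real.exp (W x) with hSdef
  choose m hm1 hm2 using fun n => (henergy n).2.2
  set Φ : ℕ → ℝ → ℝ := fun n x => ∫ t in (0 : ℝ)..x, -(H t * Real.exp (W t)) * cutoff n t with hΦ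
  set Φ' : ℝ → ℝ := fun x => ∫ t in (0 : ℝ)..x, -(H t * Real.exp (W t)) with hΦ'
  have hgc : Continuous fun t => -(H t * Real.exp (W t)) := by fun_prop
  have hΦ'c : Continuous Φ' :=
    continuous_iff_continuousAt.2 fun x => (hasDerivAt_primitive hgc x).continuousAt
  have hΦeq : ∀ (n : ℕ) (x : ℝ), |x| ≤ n → Φ n x = Φ' x := fun n x hx => by
    refine intervalIntegral.integral_congr fun t ht => ?_
    have : |t| ≤ n := by
      have h1 := Set.abs_sub_left_of_mem_uIcc ht
      simp only [sub_zero] at h1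
      exact h1.trans hx
    simp only [cutoff_eq_one this, mul_one]
  have hloc : ∀ {p : ℝ → ℝ}, Continuous p → IntegrableOn p (Set.Icc (-1) 1) := fun hp =>
    hp.continuousOn.integrableOn_compact isCompact_Icc
  set a := ∫ x in Set.Icc (-1 : ℝ) 1, Real.exp (-W x) with ha
  have ha0 : 0 < a := by
    rw [ha, setIntegral_pos_iff_support_of_nonneg_ae
      (Filter.Eventually.of_forall fun x => (Real.exp_pos _).le) hW.integrableOn]
    have : Function.support (fun x => Real.exp (-W x)) = Set.univ :=
      Set.eq_univ_of_forall fun x => (Real.exp_pos _).ne'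
    rw [this, Set.univ_inter]
    simp
  set b := ∫ x in Set.Icc (-1 : ℝ) 1, Φ' x ^ 2 * Real.exp (-W x) with hb
  -- The centring constants stay bounded: on `[-1, 1]` the cut-off primitive equals the full one, so
  -- an unbounded `m n` would violate the uniform `L²` bound there.
  have hmb : ∀ n, 1 ≤ n → m n ^ 2 * a ≤ 2 * b + 2 * (D * (D * S)) := by
    intro n hn
    have hn' : (1 : ℝ) ≤ n := by exact_mod_cast hn
    have e1 : ∫ x in Set.Icc (-1 : ℝ) 1, (Φ' x - m n) ^ 2 * Real.exp (-W x) ≤ D * (D * S) := by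
      have : ∫ x in Set.Icc (-1 : ℝ) 1, (Φ' x - m n) ^ 2 * Real.exp (-W x) =
          ∫ x in Set.Icc (-1 : ℝ) 1, (Φ n x - m n) ^ 2 * Real.exp (-W x) :=
        setIntegral_congr_fun measurableSet_Icc fun x hx => by
          simp only [hΦeq n x ((abs_le.2 hx).trans hn')]
      rw [this]
      exact (setIntegral_le_integral (hm1 n) (Filter.Eventually.of_forall fun x => by
        positivity)).trans (hm2 n)
    have e2 : m n ^ 2 * a ≤ 2 * b +
        2 * ∫ x in Set.Icc (-1 : ℝ) 1, (Φ' x - m n) ^ 2 * Real.exp (-W x) := by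
      rw [ha, hb, ← integral_const_mul, ← integral_const_mul, ← integral_const_mul,
        ← integral_add (hloc (by fun_prop)) (hloc (by fun_prop))]
      refine setIntegral_mono (hloc (by fun_prop)) (hloc (by fun_prop)) fun x => ?_
      have := Real.exp_pos (-W x)
      have h0 : m n ^ 2 ≤ 2 * Φ' x ^ 2 + 2 * (Φ' x - m n) ^ 2 := by
        nlinarith [sq_nonneg (2 * Φ' x - m n)]
      nlinarith [mul_le_mul_of_nonneg_right h0 this.le]
    linarith
  set M := (2 * b + 2 * (D * (D * S))) / a with hM
  have hΦnc : ∀ n, Continuous (Φ n) := fun n => by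
    have hχ := continuous_cutoff n
    exact continuous_iff_continuousAt.2 fun x =>
      (hasDerivAt_primitive (g := fun t => -(H t * Real.exp (W t)) * cutoff n t)
        (by fun_prop) x).continuousAt
  have hdom : ∀ n x, Φ n x ^ 2 * Real.exp (-W x) ≤
      2 * ((Φ n x - m n) ^ 2 * Real.exp (-W x)) + 2 * m n ^ 2 * Real.exp (-W x) := fun n x => by
    have := Real.exp_pos (-W x)
    have h0 : Φ n x ^ 2 ≤ 2 * (Φ n x - m n) ^ 2 + 2 * m n ^ 2 := by
      nlinarith [sq_nonneg (Φ n x - 2 * m n)]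
    nlinarith [mul_le_mul_of_nonneg_right h0 this.le]
  have hdomi : ∀ n, Integrable fun x =>
      2 * ((Φ n x - m n) ^ 2 * Real.exp (-W x)) + 2 * m n ^ 2 * Real.exp (-W x) := fun n =>
    ((hm1 n).const_mul 2).add (hW.const_mul _)
  have hΦi : ∀ n, Integrable fun x => Φ n x ^ 2 * Real.exp (-W x) := fun n => by
    have := hΦnc n
    refine (hdomi n).mono' (by fun_prop : Continuous _).aestronglyMeasurable
      (Filter.Eventually.of_forall fun x => ?_)
    rw [Real.norm_of_nonneg (by positivity)]
    exact hdom n x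
  -- The shift by one ensures that the cutoff equals `1` on `[-1, 1]`.
  refine integrable_of_tendsto_of_integral_le (G := fun n x => Φ (n + 1) x ^ 2 * Real.exp (-W x))
    (C := 2 * (D * (D * S)) + 2 * M * partition W) (fun n => ?_) (fun n x => by positivity)
    (fun n => ?_) fun x => ?_
  · exact hΦi _
  · refine (integral_mono (hΦi _) (hdomi _) (hdom (n + 1))).trans ?_
    rw [integral_add ((hm1 _).const_mul 2) (hW.const_mul _), integral_const_mul,
      integral_const_mul, show ∫ x, Real.exp (-W x) = partition W from rfl]
    have hZ := partition_pos hW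
    have : m (n + 1) ^ 2 ≤ M := by
      rw [hM, le_div_iff₀ ha0]
      exact hmb _ (by omega)
    have := hm2 (n + 1)
    gcongr
  · obtain ⟨N, hN⟩ := exists_nat_ge |x|
    refine tendsto_const_nhds.congr' ?_
    filter_upwards [Filter.eventually_ge_atTop N] with n hn
    rw [hΦeq (n + 1) x (hN.trans (by exact_mod_cast hn.trans n.le_succ))]

end Energy

/-! ### The flux and the Poisson equation. -/

/-- The function `F - A_ℝ`, that is `x ↦ ∫_{-∞}^x (f - μ(f)) exp (-V)`. -/
noncomputable def flux (V f : ℝ → ℝ) (x : ℝ) : ℝ := primitiveF V f x - constA V f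

section Flux

variable {V f : ℝ → ℝ}

theorem integrable_flux_density (hVint : Integrable fun x => Real.exp (-V x))
    (hfint : Integrable f (gibbs V)) : Integrable fun x => (f x - mean V f) * Real.exp (-V x) := by
  have := (integrable_gibbs_iff hVint f).1 hfint
  simp only [sub_mul]
  exact this.sub (hVint.const_mul (mean V f))

theorem integral_flux_density (hVint : Integrable fun x => Real.exp (-V x))
    (hfint : Integrable f (gibbs V)) : ∫ x, (f x - mean V f) * Real.exp (-V x) = 0 := by
  simp only [sub_mul]
  rw [integral_sub ((integrable_gibbs_iff hVint f).1 hfint) (hVint.const_mul _),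
    integral_const_mul, show ∫ x, Real.exp (-V x) = partition V from rfl, mean, integral_gibbs,
    div_mul_cancel₀ _ (partition_pos hVint).ne', sub_self]

theorem hasDerivAt_flux (hV : Continuous V) (hf : Continuous f) (x : ℝ) :
    HasDerivAt (flux V f) ((f x - mean V f) * Real.exp (-V x)) x :=
  (hasDerivAt_primitive (g := fun x => (f x - mean V f) * Real.exp (-V x))
    (by fun_prop) x).sub_const _

theorem flux_eq_setIntegral (hVint : Integrable fun x => Real.exp (-V x))
    (hfint : Integrable f (gibbs V)) (x : ℝ) :
    flux V f x = ∫ ξ in Set.Iic x, (f ξ - mean V f) * Real.exp (-V ξ) := by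
  have h := integrable_flux_density hVint hfint
  rw [flux, primitiveF, constA,
    ← intervalIntegral.integral_Iic_sub_Iic h.integrableOn h.integrableOn]
  ring

theorem tendsto_flux_atBot (hVint : Integrable fun x => Real.exp (-V x))
    (hfint : Integrable f (gibbs V)) : Filter.Tendsto (flux V f) Filter.atBot (nhds 0) := by
  rw [funext (flux_eq_setIntegral hVint hfint)]
  exact tendsto_integral_Iic_zero Filter.tendsto_id

theorem tendsto_flux_atTop (hVint : Integrable fun x => Real.exp (-V x))
    (hfint : Integrable f (gibbs V)) : Filter.Tendsto (flux V f) Filter.atTop (nhds 0) := by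
  have h := integrable_flux_density hVint hfint
  have h1 := intervalIntegral_tendsto_integral_Ioi 0 h.integrableOn Filter.tendsto_id
  have h2 := intervalIntegral.integral_Iic_add_Ioi (b := (0 : ℝ)) h.integrableOn h.integrableOn
  rw [integral_flux_density hVint hfint] at h2
  have h3 := h1.sub_const (constA V f)
  rw [constA, sub_neg_eq_add, add_comm, h2] at h3
  exact h3

end Flux

/-- `exp (-W)` and `exp W` are not both integrable. -/
theorem not_integrable_exp {W : ℝ → ℝ}
    (hW : Integrable fun x => Real.exp (-W x)) : ¬ Integrable fun x => Real.exp (W x) := by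
  intro h
  have h1 : Integrable fun _ : ℝ => (1 : ℝ) := by
    refine (hW.add h).mono' aestronglyMeasurable_const (Filter.Eventually.of_forall fun x => ?_)
    simp only [Pi.add_apply, norm_one]
    rcases le_total 0 (W x) with hx | hx
    · linarith [Real.one_le_exp hx, Real.exp_pos (-W x)]
    · linarith [Real.one_le_exp (neg_nonneg.2 hx), Real.exp_pos (W x)]
  rw [integrable_const_iff] at h1
  rcases h1 with h1 | h1
  · exact one_ne_zero h1
  · have := h1.measure_univ_lt_top
    simp at this

section Poisson

variable {V f U : ℝ → ℝ}

/-- The equation says that `exp (-V-U) φ'` and the negative flux have the same derivative. Equating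
them yields an explicit `φ'`, and the energy estimate places the centred primitive in `H¹(μ_U)`. -/
theorem exists_isPoissonSolution (hV : Continuous V)
    (hVint : Integrable fun x => Real.exp (-V x)) (hf : Continuous f)
    (hfint : Integrable f (gibbs V)) (hU : IsAdmissible V f U) :
    (Integrable fun x => flux V f x ^ 2 * Real.exp ((V + U) x)) ∧
    ∃ φ, IsPoissonSolution V U f φ fun x => -(flux V f x * Real.exp ((V + U) x)) := by
  have hUc := hU.smooth.continuous
  have hWc : Continuous (V + U) := hV.add hUc
  have hW := hU.integrable
  set k : ℝ → ℝ := fun x => (f x - mean V f) * Real.exp (-V x) with hk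
  have hki : Integrable k := integrable_flux_density hVint hfint
  have hH := hasDerivAt_flux hV hf
  have hHc : Continuous (flux V f) :=
    continuous_iff_continuousAt.2 fun x => (hH x).continuousAt
  -- This is the third admissibility condition rewritten: `(f - I_f)² exp (2U) exp (-V-U) = k² exp
  -- (V+U)`.
  have hk2 : Integrable fun x => k x ^ 2 * Real.exp ((V + U) x) := by
    have := (memLp_two_gibbs_iff hW (by fun_prop : Continuous _).aestronglyMeasurable).1 hU.memLp
    refine this.congr (Filter.Eventually.of_forall fun x => ?_)
    simp only [hk, Pi.add_apply, mul_pow, ← Real.exp_nat_mul, mul_assoc, ← Real.exp_add]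
    congr 2
    push_cast
    ring
  obtain ⟨h1, h2⟩ := integrable_sq_flux_and_primitive hWc hW hU.poincare hki hk2 hH
    (tendsto_flux_atBot hVint hfint) (tendsto_flux_atTop hVint hfint)
  refine ⟨h1, ?_⟩
  have hgc : Continuous fun t => -(flux V f t * Real.exp ((V + U) t)) := by fun_prop
  set g : ℝ → ℝ := fun t => -(flux V f t * Real.exp ((V + U) t)) with hg
  have hΦd := hasDerivAt_primitive hgc
  set Φ : ℝ → ℝ := fun x => ∫ t in (0 : ℝ)..x, g t with hΦ
  have hΦc : Continuous Φ := continuous_iff_continuousAt.2 fun x => (hΦd x).continuousAt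
  have hΦi := integrable_mul_exp_of_sq hW hΦc.aestronglyMeasurable h2
  have hee : ∀ x, Real.exp ((V + U) x) * Real.exp (-(V + U) x) = 1 := fun x => by
    rw [← Real.exp_add]; simp
  have hZ := partition_pos hW
  set m := ∫ x, Φ x ∂(gibbs (V + U)) with hm
  have := isProbabilityMeasure_gibbs hW
  have hΦg : Integrable Φ (gibbs (V + U)) := (integrable_gibbs_iff hW _).2 hΦi
  refine ⟨fun x => Φ x - m, (memH1_gibbs_iff hW).2
    ⟨(hasWeakDeriv_of_hasDerivAt hΦd hgc).sub_const m, ?_, ?_⟩, ?_, fun ψ hψ => ?_⟩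
  · have : (fun x => (Φ x - m) ^ 2 * Real.exp (-(V + U) x)) = fun x =>
        Φ x ^ 2 * Real.exp (-(V + U) x) - 2 * m * (Φ x * Real.exp (-(V + U) x)) +
          m ^ 2 * Real.exp (-(V + U) x) := by
      ext x; ring
    rw [this]
    exact (h2.sub (hΦi.const_mul _)).add (hW.const_mul _)
  · refine h1.congr (Filter.Eventually.of_forall fun x => ?_)
    simp only [hg]
    linear_combination -flux V f x ^ 2 * Real.exp ((V + U) x) * hee x
  · rw [integral_sub hΦg (integrable_const _)]
    simp [hm]
  · rw [integral_gibbs, integral_gibbs]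
    congr 1
    have e1 : ∀ x, g x * deriv ψ x * Real.exp (-(V + U) x) = -(flux V f x * deriv ψ x) :=
      fun x => by
        simp only [hg]
        linear_combination -flux V f x * deriv ψ x * hee x
    have e2 : ∀ x, (f x - mean V f) * Real.exp (U x) * ψ x * Real.exp (-(V + U) x) =
        k x * ψ x := fun x => by
      simp only [hk, Pi.add_apply]
      have : Real.exp (U x) * Real.exp (-(V x + U x)) = Real.exp (-V x) := by
        rw [← Real.exp_add]; ring_nf
      linear_combination (f x - mean V f) * ψ x * this
    simp only [e1, e2]
    have hkc : Continuous k := by fun_prop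
    rw [integral_neg, (hasWeakDeriv_of_hasDerivAt hH hkc).integral_eq ψ hψ, neg_neg]

theorem locallyIntegrable_mul_continuous {p q : ℝ → ℝ} (hp : LocallyIntegrable p)
    (hq : Continuous q) : LocallyIntegrable fun x => p x * q x := by
  rw [locallyIntegrable_iff] at hp ⊢
  exact fun K hK => (hp K hK).mul_continuousOn hq.continuousOn hK

theorem IsPoissonSolution.ae_eq (hV : Continuous V) (hUc : Continuous U)
    (hW : Integrable fun x => Real.exp (-(V + U) x)) {φ₁ g₁ φ₂ g₂ : ℝ → ℝ}
    (h₁ : IsPoissonSolution V U f φ₁ g₁) (h₂ : IsPoissonSolution V U f φ₂ g₂) :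
    φ₁ =ᵐ[volume] φ₂ ∧ g₁ =ᵐ[volume] g₂ := by
  have hWc : Continuous (V + U) := hV.add hUc
  have hZ := partition_pos hW
  have hec : Continuous fun x => Real.exp (-(V + U) x) := by fun_prop
  have hee : ∀ x, Real.exp ((V + U) x) * Real.exp (-(V + U) x) = 1 := fun x => by
    rw [← Real.exp_add]; simp
  obtain ⟨hw₁, hφ₁, hg₁⟩ := (memH1_gibbs_iff hW).1 h₁.memH1
  obtain ⟨hw₂, hφ₂, hg₂⟩ := (memH1_gibbs_iff hW).1 h₂.memH1
  have hl₁ := locallyIntegrable_mul_continuous hw₁.2 hec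
  have hl₂ := locallyIntegrable_mul_continuous hw₂.2 hec
  obtain ⟨c, hc⟩ := ae_eq_const_of_weakDeriv_zero (hl₁.sub hl₂) fun ψ hψ => by
    have e := (h₁.weak ψ hψ).trans (h₂.weak ψ hψ).symm
    rw [integral_gibbs, integral_gibbs, div_left_inj' hZ.ne'] at e
    have hψc := continuous_deriv_of_smoothCompact hψ
    simp only [Pi.sub_apply, sub_mul]
    rw [integral_sub (integrable_mul_of_locallyIntegrable hl₁ hψc hψ.2.deriv)
      (integrable_mul_of_locallyIntegrable hl₂ hψc hψ.2.deriv), sub_eq_zero]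
    simpa only [mul_right_comm] using e
  have hgc : ∀ᵐ x, g₁ x - g₂ x = c * Real.exp ((V + U) x) := by
    filter_upwards [hc] with x hx
    simp only [Pi.sub_apply] at hx
    linear_combination Real.exp ((V + U) x) * hx - (g₁ x - g₂ x) * hee x
  -- The difference of derivatives is `c exp (V+U)`, whose weighted square is `c² exp (V+U)`. Square
  -- integrability thus contradicts non-integrability of `exp (V+U)` unless `c = 0`.
  have hc0 : c = 0 := by
    by_contra hc0
    refine not_integrable_exp hW ?_
    have : Integrable fun x => (g₁ x - g₂ x) ^ 2 * Real.exp (-(V + U) x) := by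
      refine ((hg₁.const_mul 2).add (hg₂.const_mul 2)).mono'
        (((hw₁.2.aestronglyMeasurable.sub hw₂.2.aestronglyMeasurable).pow 2).mul
          hec.aestronglyMeasurable) (Filter.Eventually.of_forall fun x => ?_)
      rw [Real.norm_of_nonneg (by positivity)]
      simp only [Pi.add_apply]
      have := Real.exp_pos (-(V x + U x))
      have h0 : (g₁ x - g₂ x) ^ 2 ≤ 2 * g₁ x ^ 2 + 2 * g₂ x ^ 2 := by
        nlinarith [sq_nonneg (g₁ x + g₂ x)]
      nlinarith [mul_le_mul_of_nonneg_right h0 this.le]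
    refine (this.const_mul (c ^ 2)⁻¹).congr ?_
    filter_upwards [hgc] with x hx
    rw [hx, inv_mul_eq_iff_eq_mul₀ (pow_ne_zero 2 hc0)]
    linear_combination c ^ 2 * Real.exp ((V + U) x) * hee x
  have hg : g₁ =ᵐ[volume] g₂ := by
    filter_upwards [hgc] with x hx
    rw [hc0, zero_mul] at hx
    linarith
  refine ⟨?_, hg⟩
  obtain ⟨d, hd⟩ := ae_eq_const_of_weakDeriv_zero (hw₁.1.sub hw₂.1) fun ψ hψ => by
    have hψc := continuous_deriv_of_smoothCompact hψ
    simp only [Pi.sub_apply, sub_mul]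
    rw [integral_sub (integrable_mul_of_locallyIntegrable hw₁.1 hψc hψ.2.deriv)
      (integrable_mul_of_locallyIntegrable hw₂.1 hψc hψ.2.deriv), hw₁.3 ψ hψ, hw₂.3 ψ hψ,
      show ∫ x, g₁ x * ψ x = ∫ x, g₂ x * ψ x from integral_congr_ae (hg.mul (ae_eq_refl ψ))]
    simp
  have := isProbabilityMeasure_gibbs hW
  have hi : ∀ {φ : ℝ → ℝ}, LocallyIntegrable φ →
      (Integrable fun x => φ x ^ 2 * Real.exp (-(V + U) x)) → Integrable φ (gibbs (V + U)) :=
    fun h1 h2 => (integrable_gibbs_iff hW _).2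
      (integrable_mul_exp_of_sq hW h1.aestronglyMeasurable h2)
  have h3 : ∫ x, (φ₁ x - φ₂ x) ∂(gibbs (V + U)) = d := by
    have : (fun x => φ₁ x - φ₂ x) =ᵐ[gibbs (V + U)] fun _ => d :=
      (gibbs_absolutelyContinuous (V + U)).ae_le hd
    rw [integral_congr_ae this]
    simp
  rw [integral_sub (hi hw₁.1 hφ₁) (hi hw₂.1 hφ₂), h₁.integral_eq_zero, h₂.integral_eq_zero,
    sub_zero] at h3
  filter_upwards [hd] with x hx
  rw [← h3] at hx
  simpa [sub_eq_zero] using hx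

theorem poissonWellPosed (hV : Continuous V) (hVint : Integrable fun x => Real.exp (-V x))
    (hf : Continuous f) (hfint : Integrable f (gibbs V)) (hU : IsAdmissible V f U) :
    PoissonWellPosed V U f := by
  obtain ⟨-, φ, hφ⟩ := exists_isPoissonSolution hV hVint hf hfint hU
  exact ⟨φ, _, hφ, fun φ₁ g₁ h => h.ae_eq hV hU.smooth.continuous hU.integrable hφ⟩

/-- By uniqueness the chosen derivative is almost everywhere the explicit one. Normalizing `μ_U`
then cancels one factor `Z[U]`. -/
theorem asymptoticVariance_eq (hV : Continuous V) (hVint : Integrable fun x => Real.exp (-V x))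
    (hf : Continuous f) (hfint : Integrable f (gibbs V)) (hU : IsAdmissible V f U) :
    asymptoticVariance V f U = 2 * partition (V + U) / partition V ^ 2 *
      ∫ x, flux V f x ^ 2 * Real.exp ((V + U) x) := by
  obtain ⟨-, φ, hφ⟩ := exists_isPoissonSolution hV hVint hf hfint hU
  have h : ∃ p : (ℝ → ℝ) × (ℝ → ℝ), IsPoissonSolution V U f p.1 p.2 := ⟨(φ, _), hφ⟩
  have hZ := partition_pos hU.integrable
  rw [asymptoticVariance, dif_pos h, integral_gibbs]
  have hae := ((Classical.choose_spec h).ae_eq hV hU.smooth.continuous hU.integrable hφ).2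
  have : ∫ x, |(Classical.choose h).2 x| ^ 2 * Real.exp (-(V + U) x) =
      ∫ x, flux V f x ^ 2 * Real.exp ((V + U) x) := by
    refine integral_congr_ae ?_
    filter_upwards [hae] with x hx
    have hee : Real.exp ((V + U) x) * Real.exp (-(V + U) x) = 1 := by
      rw [← Real.exp_add]; simp
    rw [hx, sq_abs]
    linear_combination flux V f x ^ 2 * Real.exp ((V + U) x) * hee
  rw [this]
  field_simp

end Poisson

/-! ### Linear combinations of observables. -/

section Combination

variable {J : ℕ} {V U : ℝ → ℝ} {f : Fin J → ℝ → ℝ}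

theorem mean_sum (hfint : ∀ j, Integrable (f j) (gibbs V)) (c : Fin J → ℝ) :
    mean V (fun x => ∑ j, c j * f j x) = ∑ j, c j * mean V (f j) := by
  rw [mean, integral_finsetSum _ fun j _ => (hfint j).const_mul (c j)]
  simp only [integral_const_mul, mean]

theorem flux_sum (hVint : Integrable fun x => Real.exp (-V x))
    (hfint : ∀ j, Integrable (f j) (gibbs V)) (c : Fin J → ℝ) (x : ℝ) :
    flux V (fun x => ∑ j, c j * f j x) x = ∑ j, c j * flux V (f j) x := by
  have hsum : Integrable (fun x => ∑ j, c j * f j x) (gibbs V) :=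
    integrable_finsetSum _ fun j _ => (hfint j).const_mul (c j)
  simp only [flux_eq_setIntegral hVint (hfint _), flux_eq_setIntegral hVint hsum,
    ← integral_const_mul]
  rw [← integral_finsetSum _ fun j _ =>
    ((integrable_flux_density hVint (hfint j)).const_mul (c j)).integrableOn]
  congr with ξ
  rw [mean_sum hfint, ← Finset.sum_sub_distrib, Finset.sum_mul]
  exact Finset.sum_congr rfl fun j _ => by ring

/-- Only the `L²` condition involves the observable, and it is linear; the others are read off from
one member of the family, which exists because `0 < J`. -/
theorem isAdmissible_sum (hJ : 0 < J) (hfint : ∀ j, Integrable (f j) (gibbs V))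
    (hU : U ∈ admissible V f) (c : Fin J → ℝ) :
    IsAdmissible V (fun x => ∑ j, c j * f j x) U := by
  have h0 := hU ⟨0, hJ⟩
  refine ⟨h0.smooth, h0.integrable, h0.poincare, ?_, h0.strongSolution⟩
  have : (fun x => (∑ j, c j * f j x - mean V fun x => ∑ j, c j * f j x) * Real.exp (U x)) =
      fun x => ∑ j, c j * ((f j x - mean V (f j)) * Real.exp (U x)) := by
    ext x
    rw [mean_sum hfint, ← Finset.sum_sub_distrib, Finset.sum_mul]
    exact Finset.sum_congr rfl fun j _ => by ring
  rw [this]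
  exact memLp_finsetSum _ fun j _ => (hU j).memLp.const_mul (c j)

theorem randomObservable_eq (lam : Fin J → ℝ) (f : Fin J → ℝ → ℝ) (u : Fin J → ℝ) :
    randomObservable lam f u = fun x => ∑ j, (√(lam j) * u j) * f j x := rfl

end Combination

/-! ### Second moments of the standard Gaussian -/

instance (J : ℕ) : IsProbabilityMeasure (stdGaussianPi J) := by
  unfold stdGaussianPi
  infer_instance

theorem memLp_eval_stdGaussianPi {J : ℕ} (i : Fin J) :
    MemLp (fun u : Fin J → ℝ => u i) 2 (stdGaussianPi J) :=
  (memLp_id_gaussianReal' 2 (by simp)).comp_measurePreserving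
    (measurePreserving_eval (fun _ : Fin J => gaussianReal 0 1) i)

theorem integrable_mul_stdGaussianPi {J : ℕ} (i j : Fin J) :
    Integrable (fun u : Fin J → ℝ => u i * u j) (stdGaussianPi J) :=
  (memLp_eval_stdGaussianPi i).integrable_mul (memLp_eval_stdGaussianPi j)

theorem integral_eval_stdGaussianPi {J : ℕ} (p : ℝ → ℝ) (hp : Measurable p) (i : Fin J) :
    ∫ u, p (u i) ∂(stdGaussianPi J) = ∫ x, p x ∂(gaussianReal 0 1) := by
  have h := measurePreserving_eval (fun _ : Fin J => gaussianReal 0 1) i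
  rw [← h.map_eq, integral_map h.measurable.aemeasurable hp.aestronglyMeasurable]
  rfl

theorem integral_mul_stdGaussianPi {J : ℕ} (i j : Fin J) :
    ∫ u, u i * u j ∂(stdGaussianPi J) = if i = j then 1 else 0 := by
  have hmean : ∀ i : Fin J, ∫ u, u i ∂(stdGaussianPi J) = 0 := fun i =>
    (integral_eval_stdGaussianPi id measurable_id i).trans integral_id_gaussianReal
  split_ifs with hij
  · subst hij
    have h := integral_eval_stdGaussianPi (fun x => x * x) (by fun_prop) i
    have hv := variance_eq_sub (memLp_id_gaussianReal' (μ := 0) (v := 1) 2 (by simp))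
    rw [variance_id_gaussianReal] at hv
    have hm : ∫ x, id x ∂(gaussianReal 0 1) = 0 := integral_id_gaussianReal
    rw [h]
    simp only [hm] at hv
    simpa [pow_two] using hv.symm
  · have hind : iIndepFun (fun (i : Fin J) (u : Fin J → ℝ) => u i) (stdGaussianPi J) :=
      iIndepFun_pi (X := fun _ x => x) fun _ => aemeasurable_id
    have := (hind.indepFun hij).integral_fun_mul_eq_mul_integral
      (memLp_eval_stdGaussianPi i).1 (memLp_eval_stdGaussianPi j).1
    rw [this, hmean, zero_mul]

/-! ### The averaged variance -/

section Average

variable {J : ℕ} {V U : ℝ → ℝ} {lam : Fin J → ℝ} {f : Fin J → ℝ → ℝ}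

theorem integrable_flux_mul_flux (hV : Continuous V)
    (hVint : Integrable fun x => Real.exp (-V x)) (hf : ∀ j, Continuous (f j))
    (hfint : ∀ j, Integrable (f j) (gibbs V)) (hU : U ∈ admissible V f) (i j : Fin J) :
    Integrable fun x => flux V (f i) x * flux V (f j) x * Real.exp ((V + U) x) := by
  have hUc := (hU i).smooth.continuous
  have hc : ∀ j, Continuous (flux V (f j)) := fun j =>
    continuous_iff_continuousAt.2 fun x => (hasDerivAt_flux hV (hf j) x).continuousAt
  have hi := fun j => (exists_isPoissonSolution hV hVint (hf j) (hfint j) (hU j)).1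
  have := hc i
  have := hc j
  refine ((hi i).add (hi j)).mono' (by fun_prop : Continuous _).aestronglyMeasurable
    (Filter.Eventually.of_forall fun x => ?_)
  have he := Real.exp_pos ((V + U) x)
  rw [norm_mul, Real.norm_of_nonneg he.le]
  refine le_of_le_of_eq ?_ (add_mul (flux V (f i) x ^ 2) (flux V (f j) x ^ 2) _)
  refine mul_le_mul_of_nonneg_right ?_ he.le
  rw [Real.norm_eq_abs, abs_le]
  constructor <;> nlinarith [sq_nonneg (flux V (f i) x + flux V (f j) x),
    sq_nonneg (flux V (f i) x - flux V (f j) x), sq_nonneg (flux V (f i) x),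
    sq_nonneg (flux V (f j) x)]

/-- The flux is linear in the observable, so the variance is a quadratic form in `u`; Gaussian
second moments then settle both integrability and the expectation. -/
theorem asymptoticVariance_randomObservable (hJ : 0 < J) (hV : Continuous V)
    (hVint : Integrable fun x => Real.exp (-V x)) (hf : ∀ j, Continuous (f j))
    (hfint : ∀ j, Integrable (f j) (gibbs V)) (hU : U ∈ admissible V f) (u : Fin J → ℝ) :
    asymptoticVariance V (randomObservable lam f u) U = ∑ i, ∑ j, (2 * partition (V + U) /
      partition V ^ 2 * √(lam i) * √(lam j) *
        ∫ x, flux V (f i) x * flux V (f j) x * Real.exp ((V + U) x)) * (u i * u j) := by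
  have hsum : Integrable (fun x => ∑ j, (√(lam j) * u j) * f j x) (gibbs V) :=
    integrable_finsetSum _ fun j _ => (hfint j).const_mul _
  have hij := integrable_flux_mul_flux hV hVint hf hfint hU
  have hcont : Continuous fun x => ∑ j, (√(lam j) * u j) * f j x :=
    continuous_finsetSum _ fun j _ => continuous_const.mul (hf j)
  rw [randomObservable_eq, asymptoticVariance_eq hV hVint hcont hsum
    (isAdmissible_sum hJ hfint hU _)]
  have : ∀ x, flux V (fun x => ∑ j, (√(lam j) * u j) * f j x) x ^ 2 * Real.exp ((V + U) x) =
      ∑ i, ∑ j, (√(lam i) * u i * (√(lam j) * u j)) *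
        (flux V (f i) x * flux V (f j) x * Real.exp ((V + U) x)) := fun x => by
    rw [flux_sum hVint hfint, pow_two, Finset.sum_mul_sum, Finset.sum_mul]
    refine Finset.sum_congr rfl fun i _ => ?_
    rw [Finset.sum_mul]
    exact Finset.sum_congr rfl fun j _ => by ring
  simp only [this]
  rw [integral_finsetSum _ fun i _ => integrable_finsetSum _ fun j _ => (hij i j).const_mul _,
    Finset.mul_sum]
  refine Finset.sum_congr rfl fun i _ => ?_
  rw [integral_finsetSum _ fun j _ => (hij i j).const_mul _, Finset.mul_sum]
  refine Finset.sum_congr rfl fun j _ => ?_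
  rw [integral_const_mul]
  ring

theorem integrable_asymptoticVariance (hJ : 0 < J) (hV : Continuous V)
    (hVint : Integrable fun x => Real.exp (-V x)) (hf : ∀ j, Continuous (f j))
    (hfint : ∀ j, Integrable (f j) (gibbs V)) (hU : U ∈ admissible V f) :
    Integrable (fun u => asymptoticVariance V (randomObservable lam f u) U) (stdGaussianPi J) := by
  simp only [asymptoticVariance_randomObservable hJ hV hVint hf hfint hU]
  exact integrable_finsetSum _ fun i _ => integrable_finsetSum _ fun j _ =>
    (integrable_mul_stdGaussianPi i j).const_mul _

theorem averagedVariance_eq_sum (hJ : 0 < J) (hV : Continuous V)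
    (hVint : Integrable fun x => Real.exp (-V x)) (hlam : ∀ j, 0 < lam j)
    (hf : ∀ j, Continuous (f j))
    (hfint : ∀ j, Integrable (f j) (gibbs V)) (hU : U ∈ admissible V f) :
    averagedVariance V lam f U = ∑ j, lam j * asymptoticVariance V (f j) U := by
  simp only [averagedVariance, asymptoticVariance_randomObservable hJ hV hVint hf hfint hU]
  rw [integral_finsetSum _ fun i _ => integrable_finsetSum _ fun j _ =>
    (integrable_mul_stdGaussianPi i j).const_mul _]
  refine Finset.sum_congr rfl fun i _ => ?_
  rw [integral_finsetSum _ fun j _ => (integrable_mul_stdGaussianPi i j).const_mul _]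
  simp only [integral_const_mul, integral_mul_stdGaussianPi, mul_ite, mul_one, mul_zero,
    Finset.sum_ite_eq, Finset.mem_univ, if_true]
  rw [asymptoticVariance_eq hV hVint (hf i) (hfint i) (hU i)]
  simp only [← pow_two]
  have := Real.mul_self_sqrt (hlam i).le
  linear_combination (2 * partition (V + U) / partition V ^ 2 *
    ∫ x, flux V (f i) x ^ 2 * Real.exp ((V + U) x)) * this

theorem optimalDensity_eq (V : ℝ → ℝ) (lam : Fin J → ℝ) (f : Fin J → ℝ → ℝ) (x : ℝ) :
    optimalDensity V lam f x = √(∑ j, lam j * flux V (f j) x ^ 2) := by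
  simp only [optimalDensity, sq_abs, flux]

theorem averagedVariance_eq_integral (hJ : 0 < J) (hV : Continuous V)
    (hVint : Integrable fun x => Real.exp (-V x)) (hlam : ∀ j, 0 < lam j)
    (hf : ∀ j, Continuous (f j))
    (hfint : ∀ j, Integrable (f j) (gibbs V)) (hU : U ∈ admissible V f) :
    (Integrable fun x => (∑ j, lam j * flux V (f j) x ^ 2) * Real.exp ((V + U) x)) ∧
    averagedVariance V lam f U = 2 / partition V ^ 2 * (partition (V + U) *
      ∫ x, (∑ j, lam j * flux V (f j) x ^ 2) * Real.exp ((V + U) x)) := by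
  have hi := fun j => (exists_isPoissonSolution hV hVint (hf j) (hfint j) (hU j)).1
  simp only [Finset.sum_mul, mul_assoc]
  refine ⟨integrable_finsetSum _ fun j _ => (hi j).const_mul _, ?_⟩
  rw [averagedVariance_eq_sum hJ hV hVint hlam hf hfint hU,
    integral_finsetSum _ fun j _ => (hi j).const_mul _, Finset.mul_sum, Finset.mul_sum]
  refine Finset.sum_congr rfl fun j _ => ?_
  rw [integral_const_mul, asymptoticVariance_eq hV hVint (hf j) (hfint j) (hU j)]
  ring

end Average

/-! ### Optimization over the biasing potential. -/

section Optimization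

variable {W N : ℝ → ℝ}

/-- By the arithmetic-geometric mean inequality, `2 √N ≤ exp (-W) + N exp W`. -/
theorem integrable_sqrt_of_integrable_mul_exp (hN : Continuous N) (hN0 : ∀ x, 0 ≤ N x)
    (hW : Integrable fun x => Real.exp (-W x))
    (hNW : Integrable fun x => N x * Real.exp (W x)) : Integrable fun x => √(N x) := by
  refine (hW.add hNW).mono' (by fun_prop : Continuous _).aestronglyMeasurable
    (Filter.Eventually.of_forall fun x => ?_)
  rw [Real.norm_of_nonneg (Real.sqrt_nonneg _)]
  simp only [Pi.add_apply]
  have hee : Real.exp (W x) * Real.exp (-W x) = 1 := by rw [← Real.exp_add]; simp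
  have h := mul_nonneg (sq_nonneg (√(N x) * Real.exp (W x) - 1)) (Real.exp_pos (-W x)).le
  have hs := Real.sq_sqrt (hN0 x)
  have h1 : (√(N x) * Real.exp (W x) - 1) ^ 2 * Real.exp (-W x) =
      N x * Real.exp (W x) - 2 * √(N x) + Real.exp (-W x) := by
    linear_combination (Real.exp (W x) * (Real.exp (W x) * Real.exp (-W x))) * hs +
      (N x * Real.exp (W x) - 2 * √(N x)) * hee
  linarith [Real.sqrt_nonneg (N x)]

/-- Cauchy-Schwarz for `1` and `√N exp W` with weight `exp (-W)`. This is the lower bound of the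
theorem. -/
theorem sq_integral_sqrt_le (hN : Continuous N) (hN0 : ∀ x, 0 ≤ N x)
    (hW : Integrable fun x => Real.exp (-W x))
    (hNW : Integrable fun x => N x * Real.exp (W x)) :
    (∫ x, √(N x)) ^ 2 ≤ partition W * ∫ x, N x * Real.exp (W x) := by
  have hee : ∀ x, Real.exp (W x) * Real.exp (-W x) = 1 := fun x => by
    rw [← Real.exp_add]; simp
  have e1 : (fun x => (1 : ℝ) ^ 2 * Real.exp (-W x)) = fun x => Real.exp (-W x) := by simp
  have e2 : (fun x => (√(N x) * Real.exp (W x)) ^ 2 * Real.exp (-W x)) =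
      fun x => N x * Real.exp (W x) := by
    ext x
    linear_combination (Real.exp (W x) * (Real.exp (W x) * Real.exp (-W x))) *
      Real.sq_sqrt (hN0 x) + N x * Real.exp (W x) * hee x
  have e3 : (fun x => 1 * (√(N x) * Real.exp (W x)) * Real.exp (-W x)) = fun x => √(N x) := by
    ext x
    linear_combination √(N x) * hee x
  have := sq_integral_mul_le (w := fun x => Real.exp (-W x)) (f := fun _ => 1)
    (g := fun x => √(N x) * Real.exp (W x)) (fun x => (Real.exp_pos _).le)
    (by rw [e1]; exact hW) (by rw [e2]; exact hNW)
    (by rw [e3]; exact integrable_sqrt_of_integrable_mul_exp hN hN0 hW hNW)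
  rwa [e1, e2, e3] at this

/-- A domination of `q ^ χ` uniform in the cutoff `χ`, used for both `q` and `q⁻¹`. -/
theorem exp_mul_log_le {χ q : ℝ} (hχ : χ ∈ Set.Icc (0 : ℝ) 1) (hq : 0 < q) :
    Real.exp (χ * Real.log q) ≤ 1 + q := by
  rcases le_total 0 (Real.log q) with h | h
  · have : Real.exp (χ * Real.log q) ≤ Real.exp (Real.log q) :=
      Real.exp_le_exp.2 (by nlinarith [hχ.2])
    rw [Real.exp_log hq] at this
    linarith
  · have : Real.exp (χ * Real.log q) ≤ 1 := Real.exp_le_one_iff.2 (by nlinarith [hχ.1])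
    linarith

/-- Truncating the logarithm of a positive smooth density gives compactly supported biasing
potentials that realize its cost in the limit. -/
theorem le_of_forall_smoothCompact {V q : ℝ → ℝ} (hVc : Continuous V) (hN : Continuous N)
    (hN0 : ∀ x, 0 ≤ N x) (hVint : Integrable fun x => Real.exp (-V x))
    (hNV : Integrable fun x => N x * Real.exp (V x)) (hq : ContDiff ℝ ∞ q) (hq0 : ∀ x, 0 < q x)
    (hqi : Integrable fun x => q x * Real.exp (-V x))
    (hqi' : Integrable fun x => N x * Real.exp (V x) * (q x)⁻¹) {c : ℝ}
    (hc : ∀ U ∈ smoothCompact, c ≤ partition (V + U) * ∫ x, N x * Real.exp ((V + U) x)) :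
    c ≤ (∫ x, q x * Real.exp (-V x)) * ∫ x, N x * Real.exp (V x) * (q x)⁻¹ := by
  let b : ℕ → ContDiffBump (0 : ℝ) := fun k => ⟨k + 1, k + 2, by positivity, by linarith⟩
  have hb : ∀ k x, b k x ∈ Set.Icc (0 : ℝ) 1 := fun k x => ⟨(b k).nonneg, (b k).le_one⟩
  have hb1 : ∀ x, ∀ᶠ k in Filter.atTop, b k x = 1 := fun x => by
    obtain ⟨M, hM⟩ := exists_nat_ge |x|
    filter_upwards [Filter.eventually_ge_atTop M] with k hk
    refine (b k).one_of_mem_closedBall ?_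
    rw [mem_closedBall_zero_iff, Real.norm_eq_abs]
    have : (M : ℝ) ≤ k := by exact_mod_cast hk
    change |x| ≤ (k : ℝ) + 1
    linarith
  -- With this choice `exp (-u k)` is `q` to the power `b k`, which equals `q` wherever the bump is
  -- `1` and `1` outside its support.
  set u : ℕ → ℝ → ℝ := fun k x => -(b k x * Real.log (q x)) with hu
  have hlog : ContDiff ℝ ∞ fun x => Real.log (q x) := hq.log fun x => (hq0 x).ne'
  have husmooth : ∀ k, u k ∈ smoothCompact := fun k =>
    ⟨((b k).contDiff.mul hlog).neg, ((b k).hasCompactSupport.mul_right).neg⟩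
  have hqc := hq.continuous
  have huc : ∀ k, Continuous (u k) := fun k => (husmooth k).1.continuous
  have hlim1 : Filter.Tendsto (fun k => partition (V + u k)) Filter.atTop
      (nhds (∫ x, q x * Real.exp (-V x))) := by
    refine tendsto_integral_of_dominated_convergence
      (fun x => Real.exp (-V x) + q x * Real.exp (-V x)) (fun k => ?_) (hVint.add hqi)
      (fun k => Filter.Eventually.of_forall fun x => ?_) (Filter.Eventually.of_forall fun x => ?_)
    · have := huc k
      exact (by fun_prop : Continuous _).aestronglyMeasurable
    · rw [Real.norm_of_nonneg (Real.exp_pos _).le, Pi.add_apply, neg_add, Real.exp_add]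
      simp only [hu, neg_neg]
      nlinarith [exp_mul_log_le (hb k x) (hq0 x), Real.exp_pos (-V x)]
    · refine tendsto_const_nhds.congr' ((hb1 x).mono fun k hk => ?_)
      simp only [Pi.add_apply, neg_add, Real.exp_add, hu, neg_neg, hk, one_mul,
        Real.exp_log (hq0 x)]
      ring
  have hlim2 : Filter.Tendsto (fun k => ∫ x, N x * Real.exp ((V + u k) x)) Filter.atTop
      (nhds (∫ x, N x * Real.exp (V x) * (q x)⁻¹)) := by
    refine tendsto_integral_of_dominated_convergence
      (fun x => N x * Real.exp (V x) + N x * Real.exp (V x) * (q x)⁻¹) (fun k => ?_)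
      (hNV.add hqi') (fun k => Filter.Eventually.of_forall fun x => ?_)
      (Filter.Eventually.of_forall fun x => ?_)
    · have := huc k
      exact (by fun_prop : Continuous _).aestronglyMeasurable
    · have h0 : 0 ≤ N x * Real.exp (V x) := mul_nonneg (hN0 x) (Real.exp_pos _).le
      rw [Real.norm_of_nonneg (mul_nonneg (hN0 x) (Real.exp_pos _).le), Pi.add_apply, Real.exp_add]
      simp only [hu]
      rw [← mul_neg, ← Real.log_inv]
      nlinarith [exp_mul_log_le (hb k x) (inv_pos.2 (hq0 x))]
    · refine tendsto_const_nhds.congr' ((hb1 x).mono fun k hk => ?_)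
      simp only [Pi.add_apply, Real.exp_add, hu, hk, one_mul, Real.exp_neg,
        Real.exp_log (hq0 x)]
      ring
  exact ge_of_tendsto' (hlim1.mul hlim2) fun k => hc _ (husmooth k)

/-- No lower bound over compactly supported biasing potentials exceeds the optimal value. -/
theorem le_sq_integral_sqrt {V : ℝ → ℝ} (hV : ContDiff ℝ ∞ V) (hN : ContDiff ℝ ∞ N)
    (hN0 : ∀ x, 0 ≤ N x) (hVint : Integrable fun x => Real.exp (-V x))
    (hNV : Integrable fun x => N x * Real.exp (V x)) {c : ℝ}
    (hc : ∀ U ∈ smoothCompact, c ≤ partition (V + U) * ∫ x, N x * Real.exp ((V + U) x)) :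
    c ≤ (∫ x, √(N x)) ^ 2 := by
  have hVc := hV.continuous
  have hNc := hN.continuous
  have hsi := integrable_sqrt_of_integrable_mul_exp hNc hN0 hVint hNV
  have hZ := partition_pos hVint
  have hI0 : 0 ≤ ∫ x, √(N x) := integral_nonneg fun x => Real.sqrt_nonneg _
  have key : ∀ ε : ℝ, 0 < ε →
      c ≤ ((∫ x, √(N x)) + ε * partition V) * ∫ x, √(N x) := by
    intro ε hε
    -- The ideal `exp (-U)` is `√N exp V`, which may vanish and fail to be smooth; `ε` repairs both.
    -- It costs at most `ε exp (-V)` in the first integral and nothing in the second.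
    set q : ℝ → ℝ := fun x => √(N x * Real.exp (V x) ^ 2 + ε ^ 2) with hq
    have hpos : ∀ x, 0 < N x * Real.exp (V x) ^ 2 + ε ^ 2 := fun x => by
      have := mul_nonneg (hN0 x) (sq_nonneg (Real.exp (V x)))
      positivity
    have hq0 : ∀ x, 0 < q x := fun x => Real.sqrt_pos.2 (hpos x)
    have hqsmooth : ContDiff ℝ ∞ q :=
      ((hN.mul (hV.exp.pow 2)).add contDiff_const).sqrt fun x => (hpos x).ne'
    have hqc := hqsmooth.continuous
    have hupper : ∀ x, q x * Real.exp (-V x) ≤ √(N x) + ε * Real.exp (-V x) := fun x => by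
      have h1 : q x ≤ √(N x) * Real.exp (V x) + ε := by
        refine Real.sqrt_le_iff.2 ⟨by positivity, ?_⟩
        have := Real.sq_sqrt (hN0 x)
        have h2 : 0 ≤ √(N x) * Real.exp (V x) * ε := by positivity
        nlinarith
      have hee : Real.exp (V x) * Real.exp (-V x) = 1 := by rw [← Real.exp_add]; simp
      have h2 := mul_le_mul_of_nonneg_right h1 (Real.exp_pos (-V x)).le
      have h3 : (√(N x) * Real.exp (V x) + ε) * Real.exp (-V x) =
          √(N x) + ε * Real.exp (-V x) := by linear_combination √(N x) * hee
      linarith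
    have hlower : ∀ x, N x * Real.exp (V x) * (q x)⁻¹ ≤ √(N x) := fun x => by
      rw [mul_inv_le_iff₀ (hq0 x)]
      have h1 : √(N x) * Real.exp (V x) ≤ q x := by
        refine Real.le_sqrt_of_sq_le ?_
        rw [mul_pow, Real.sq_sqrt (hN0 x)]
        linarith [sq_nonneg ε]
      have h2 := mul_le_mul_of_nonneg_left h1 (Real.sqrt_nonneg (N x))
      have h3 := Real.mul_self_sqrt (hN0 x)
      linear_combination h2 - Real.exp (V x) * h3
    have hbd := hsi.add (hVint.const_mul ε)
    have hqi : Integrable fun x => q x * Real.exp (-V x) := by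
      refine hbd.mono' (by fun_prop : Continuous _).aestronglyMeasurable
        (Filter.Eventually.of_forall fun x => ?_)
      rw [Real.norm_of_nonneg (mul_nonneg (hq0 x).le (Real.exp_pos _).le)]
      exact hupper x
    have hqi' : Integrable fun x => N x * Real.exp (V x) * (q x)⁻¹ := by
      refine hsi.mono' ((by fun_prop : Continuous fun x => N x * Real.exp (V x)).mul
        (hqc.inv₀ fun x => (hq0 x).ne')).aestronglyMeasurable
        (Filter.Eventually.of_forall fun x => ?_)
      rw [Real.norm_of_nonneg (mul_nonneg (mul_nonneg (hN0 x) (Real.exp_pos _).le)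
        (inv_pos.2 (hq0 x)).le)]
      exact hlower x
    refine (le_of_forall_smoothCompact hVc hNc hN0 hVint hNV hqsmooth hq0 hqi hqi' hc).trans ?_
    refine mul_le_mul ?_ (integral_mono hqi' hsi hlower)
      (integral_nonneg fun x => mul_nonneg (mul_nonneg (hN0 x) (Real.exp_pos _).le)
        (inv_pos.2 (hq0 x)).le) (by positivity)
    refine (integral_mono hqi hbd hupper).trans (le_of_eq ?_)
    simp only [Pi.add_apply]
    rw [integral_add hsi (hVint.const_mul ε), integral_const_mul]
    rfl
  have hlim : Filter.Tendsto (fun ε : ℝ => ((∫ x, √(N x)) + ε * partition V) * ∫ x, √(N x))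
      (nhdsWithin 0 (Set.Ioi 0)) (nhds (((∫ x, √(N x)) + 0 * partition V) * ∫ x, √(N x))) :=
    tendsto_nhdsWithin_of_tendsto_nhds (Continuous.tendsto (by fun_prop) 0)
  rw [zero_mul, add_zero, ← pow_two] at hlim
  exact ge_of_tendsto hlim (by filter_upwards [self_mem_nhdsWithin] with ε hε using key ε hε)

end Optimization

theorem contDiff_flux {V f : ℝ → ℝ} (hV : ContDiff ℝ ∞ V) (hf : ContDiff ℝ ∞ f) :
    ContDiff ℝ ∞ (flux V f) := by
  have hd := hasDerivAt_flux hV.continuous hf.continuous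
  rw [contDiff_infty_iff_deriv, funext fun x => (hd x).deriv]
  exact ⟨fun x => (hd x).differentiableAt, (hf.sub contDiff_const).mul hV.neg.exp⟩

end BiasedLangevin

theorem mainTheorem9 (J : ℕ) (hJ : 0 < J) (V : ℝ → ℝ) (lam : Fin J → ℝ) (f : Fin J → ℝ → ℝ)
    (hV : ContDiff ℝ ∞ V) (hVint : Integrable fun x => Real.exp (-V x))
    (hlam : ∀ j, 0 < lam j)
    (hf : ∀ j, ContDiff ℝ ∞ (f j))
    (hfint : ∀ j, Integrable (f j) (BiasedLangevin.gibbs V))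
    (hfconst : ∀ j, ¬ ∃ c : ℝ, ∀ᵐ x ∂(BiasedLangevin.gibbs V), f j x = c)
    (h0 : (0 : ℝ → ℝ) ∈ BiasedLangevin.admissible V f) :
    BiasedLangevin.smoothCompact ⊆ BiasedLangevin.admissible V f ∧
    (∀ U ∈ BiasedLangevin.admissible V f,
      (∀ j, BiasedLangevin.PoissonWellPosed V U (f j)) ∧
      (∀ u : Fin J → ℝ,
        BiasedLangevin.PoissonWellPosed V U (BiasedLangevin.randomObservable lam f u)) ∧
      Integrable (fun u => BiasedLangevin.asymptoticVariance V
        (BiasedLangevin.randomObservable lam f u) U) (BiasedLangevin.stdGaussianPi J) ∧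
      BiasedLangevin.averagedVariance V lam f U =
        ∑ j, lam j * BiasedLangevin.asymptoticVariance V (f j) U) ∧
    Integrable (BiasedLangevin.optimalDensity V lam f) ∧
    IsGLB (BiasedLangevin.averagedVariance V lam f '' BiasedLangevin.admissible V f)
      (2 / BiasedLangevin.partition V ^ 2 *
        (∫ x, BiasedLangevin.optimalDensity V lam f x) ^ 2) ∧
    IsGLB (BiasedLangevin.averagedVariance V lam f '' BiasedLangevin.smoothCompact)
      (2 / BiasedLangevin.partition V ^ 2 *
        (∫ x, BiasedLangevin.optimalDensity V lam f x) ^ 2) := by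
  open BiasedLangevin in
  have hVc := hV.continuous
  have hfc := fun j => (hf j).continuous
  have hsub : smoothCompact ⊆ admissible V f := fun U hU j =>
    (h0 j).add_smoothCompact hV hVint (hfc j) hU
  set N : ℝ → ℝ := fun x => ∑ j, lam j * flux V (f j) x ^ 2 with hN
  have hNs : ContDiff ℝ ∞ N := ContDiff.sum fun j _ =>
    contDiff_const.mul ((contDiff_flux hV (hf j)).pow 2)
  have hN0 : ∀ x, 0 ≤ N x := fun x =>
    Finset.sum_nonneg fun j _ => mul_nonneg (hlam j).le (sq_nonneg _)
  have hdens : optimalDensity V lam f = fun x => √(N x) := funext (optimalDensity_eq V lam f)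
  have havg := fun U (hU : U ∈ admissible V f) =>
    averagedVariance_eq_integral hJ hVc hVint hlam hfc hfint hU
  have hNV : Integrable fun x => N x * Real.exp (V x) := by simpa using (havg 0 h0).1
  have hZ : 0 < 2 / partition V ^ 2 := div_pos two_pos (pow_pos (partition_pos hVint) 2)
  have hlower : ∀ U ∈ admissible V f,
      2 / partition V ^ 2 * (∫ x, √(N x)) ^ 2 ≤ averagedVariance V lam f U := fun U hU => by
    rw [(havg U hU).2]
    exact mul_le_mul_of_nonneg_left (sq_integral_sqrt_le hNs.continuous hN0
      (hU ⟨0, hJ⟩).integrable (havg U hU).1) hZ.le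
  have hgreatest : ∀ c ∈ lowerBounds (averagedVariance V lam f '' smoothCompact),
      c ≤ 2 / partition V ^ 2 * (∫ x, √(N x)) ^ 2 := fun c hc => by
    rw [← div_le_iff₀' hZ]
    refine le_sq_integral_sqrt hV hNs hN0 hVint hNV fun U hU => ?_
    rw [div_le_iff₀' hZ, ← (havg U (hsub hU)).2]
    exact hc ⟨U, hU, rfl⟩
  refine ⟨hsub, fun U hU => ⟨fun j => poissonWellPosed hVc hVint (hfc j) (hfint j) (hU j),
    fun u => ?_, integrable_asymptoticVariance hJ hVc hVint hfc hfint hU,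
    averagedVariance_eq_sum hJ hVc hVint hlam hfc hfint hU⟩, ?_, ?_, ?_⟩
  · exact poissonWellPosed hVc hVint
      (continuous_finsetSum _ fun j _ => continuous_const.mul (hfc j))
      (integrable_finsetSum _ fun j _ => (hfint j).const_mul _) (isAdmissible_sum hJ hfint hU _)
  · rw [hdens]
    exact integrable_sqrt_of_integrable_mul_exp hNs.continuous hN0 hVint hNV
  · rw [hdens]
    -- A lower bound over all admissible potentials is one over the compactly supported ones, where
    -- optimality is already known.
    refine ⟨?_, fun c hc => hgreatest c (lowerBounds_mono_set (Set.image_mono hsub) hc)⟩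
    rintro _ ⟨U, hU, rfl⟩
    exact hlower U hU
  · rw [hdens]
    refine ⟨?_, hgreatest⟩
    rintro _ ⟨U, hU, rfl⟩
    exact hlower U (hsub hU)
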